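/- Let $k$ be an algebraically closed field of characteristic $0$, $G$ a finite abelian group, $\chi: G\to k^\times$ a character, $a\in G$, $\ell$ the order of $\chi(a)$, and $\Gamma=\operatorname{Hom}(G,k^\times)$. Let $H=H_{\mathcal D}$ be the Hopf algebra generated as a $k$-algebra by the group $G$ and an element $x$ with relations $x^\ell=0$ and $xg=\chi(g)gx$ for all $g\in G$, with $\Delta(x)=x\otimes a+1\otimes x$ and $\Delta(g)=g\otimes g$. Its Drinfel'd double $D(H)$ is $H^*\otimes H$ with the product $$(f\otimes h)(f'\otimes h')=\sum f\,(h_1\rightharpoonup f'\leftharpoonup S^{-1}(h_3))\otimes h_2h',\qquad \langle p\rightharpoonup f'\leftharpoonup r,b\rangle=\langle f',rbp\rangle .$$ A $D(H)$-module $M$ is also a left-right Yetter-Drinfel'd $H$-module, that is, a left $H$-module and right $H$-comodule with $\sum h_1m_0\otimes h_2m_1=\sum(h_2m)_0\otimes(h_2m)_1h_1$, and conversely; here $H$ acts as in $D(H)$ and $f\in H^*$ acts by $f\cdot m=\sum\langle f,m_1\rangle m_0$. A character $\beta\in\Gamma$ is regarded as an algebra map $H\to k$, hence as an element of $H^*$,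 by $\beta(x)=0$. Let $H_\beta$ be the Yetter-Drinfel'd module $H$ with coaction $\Delta$ and action $h\cdot_\beta b=\sum\langle\beta,h_2\rangle h_3\,b\,S^{-1}(h_1)$; for $g\in G$ let $H\cdot_\beta g=\{h\cdot_\beta g : h\in H\}\subseteq H_\beta$, which is a Yetter-Drinfel'd submodule. Let $\operatorname{ev}_{\chi^{-1}a}: G\times\Gamma\to k^\times$ be the character $(g,\gamma)\mapsto\chi(g)^{-1}\gamma(a)$ and $K=\ker(\operatorname{ev}_{\chi^{-1}a})$. 1. For every algebra map $\alpha: D(H)\to k$ there is exactly one pair $(g_\alpha,\beta_\alpha)\in G\times\Gamma$ with $\alpha(\gamma\otimes h)=\beta_\alpha(h)\,\gamma(g_\alpha)$ for all $h\in G$, $\gamma\in\Gamma$ (written $\alpha=\beta_\alpha g_\alpha$), and the one-dimensional module $k_\alpha$, on which $u\in D(H)$ acts as multiplication by $\alpha(u)$, satisfies $$k_\alpha\simeq H\cdot_{\beta_\alpha}g_\alpha\quad\text{as Yetter-Drinfel'd } H\text{-modules.}$$ 2. Suppose $\chi(a)\neq1$ (that is, $\ell>1$). A pair $(g,\beta)\in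 G\times\Gamma$ is of the form $(g_\alpha,\beta_\alpha)$ for some algebra map $\alpha: D(H)\to k$ if and only if $(g,\beta)\in K$, and $$(g,\beta)\longmapsto[H\cdot_\beta g]$$ is a bijection from $K$ onto the set of isomorphism classes of one-dimensional $D(H)$-modules. -/

import Mathlib

set_option linter.unusedSectionVars false

universe u v

open scoped TensorProduct

namespace KropRadford

noncomputable section

section Double

lemma map_map_apply {k A B C A' B' C' : Type*} [Field k] [AddCommMonoid A] [Module k A]
    [AddCommMonoid B] [Module k B] [AddCommMonoid C] [Module k C] [AddCommMonoid A'] [Module k A']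
    [AddCommMonoid B'] [Module k B'] [AddCommMonoid C'] [Module k C'] (f : B →ₗ[k] C)
    (g : B' →ₗ[k] C') (f' : A →ₗ[k] B) (g' : A' →ₗ[k] B') (t : A ⊗[k] A') :
    TensorProduct.map f g (TensorProduct.map f' g' t) =
      TensorProduct.map (f ∘ₗ f') (g ∘ₗ g') t := by
  rw [TensorProduct.map_comp, LinearMap.comp_apply]

open Coalgebra HopfAlgebra WithConv

variable (k : Type*) [Field k] (H : Type*) [Ring H] [HopfAlgebra k H]

/-- The antipode of `H` is bijective. (This holds for every finite-dimensional Hopf algebra.) -/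
class BijectiveAntipode : Prop where
  bijective : Function.Bijective (antipode k (A := H))

/-- The dual algebra `H^*`, with the convolution product
`⟨f f', h⟩ = ∑ ⟨f, h₁⟩ ⟨f', h₂⟩`. -/
abbrev DualAlg := WithConv (H →ₗ[k] k)

/-- The iterated comultiplication `h ↦ ∑ h₁ ⊗ (h₂ ⊗ h₃)`. -/
def comul₃ : H →ₐ[k] H ⊗[k] (H ⊗[k] H) :=
  (Algebra.TensorProduct.map (.id k H) (Bialgebra.comulAlgHom k H)).comp
    (Bialgebra.comulAlgHom k H)

variable {k H} in
/-- The linear map on a threefold tensor product defined by a trilinear map. -/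
def lift₃ {M₁ M₂ M₃ V : Type*} [AddCommGroup M₁] [Module k M₁] [AddCommGroup M₂] [Module k M₂]
    [AddCommGroup M₃] [Module k M₃] [AddCommGroup V] [Module k V]
    (B : M₁ →ₗ[k] M₂ →ₗ[k] M₃ →ₗ[k] V) : M₁ ⊗[k] (M₂ ⊗[k] M₃) →ₗ[k] V :=
  TensorProduct.lift (TensorProduct.uncurry (.id k) M₂ M₃ V ∘ₗ B)

variable {k H} in
@[simp] lemma lift₃_tmul {M₁ M₂ M₃ V : Type*} [AddCommGroup M₁] [Module k M₁] [AddCommGroup M₂]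
    [Module k M₂] [AddCommGroup M₃] [Module k M₃] [AddCommGroup V] [Module k V]
    (B : M₁ →ₗ[k] M₂ →ₗ[k] M₃ →ₗ[k] V) (x : M₁) (y : M₂) (z : M₃) :
    lift₃ B (x ⊗ₜ (y ⊗ₜ z)) = B x y z := rfl

section antipodeInv

variable [BijectiveAntipode k H]

/-- The inverse `S⁻¹` of the antipode. -/
def antipodeInv : H →ₗ[k] H :=
  (LinearEquiv.ofBijective (antipode k (A := H)) BijectiveAntipode.bijective).symm.toLinearMap

variable {H}

@[simp] lemma antipode_antipodeInv (h : H) : antipode k (antipodeInv k H h) = h :=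
  (LinearEquiv.ofBijective (antipode k (A := H)) BijectiveAntipode.bijective).apply_symm_apply h

@[simp] lemma antipodeInv_antipode (h : H) : antipodeInv k H (antipode k h) = h :=
  (LinearEquiv.ofBijective (antipode k (A := H)) BijectiveAntipode.bijective).symm_apply_apply h

variable (H) in
lemma antipode_injective : Function.Injective (antipode k (A := H)) :=
  BijectiveAntipode.bijective.1

@[simp] lemma antipodeInv_one : antipodeInv k H 1 = 1 :=
  antipode_injective k H (by simp)

lemma antipodeInv_mul (u v : H) :
    antipodeInv k H (u * v) = antipodeInv k H v * antipodeInv k H u :=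
  antipode_injective k H (by simp [antipode_mul_antidistrib])

/-- `∑ S⁻¹(h₂) h₁ = ε(h)` -/
lemma sum_antipodeInv_mul {ι : Type*} {h : H} (r : Coalgebra.Repr k h ι) :
    ∑ i ∈ r.index, antipodeInv k H (r.right i) * r.left i = algebraMap k H (counit h) := by
  apply antipode_injective k H
  simp only [map_sum, antipode_mul_antidistrib, antipode_antipodeInv,
    sum_antipode_mul_eq_algebraMap_counit]
  rw [Algebra.algebraMap_eq_smul_one, map_smul, antipode_one]

/-- `∑ h₂ S⁻¹(h₁) = ε(h)` -/
lemma sum_mul_antipodeInv {ι : Type*} {h : H} (r : Coalgebra.Repr k h ι) :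
    ∑ i ∈ r.index, r.right i * antipodeInv k H (r.left i) = algebraMap k H (counit h) := by
  apply antipode_injective k H
  simp only [map_sum, antipode_mul_antidistrib, antipode_antipodeInv,
    sum_mul_antipode_eq_algebraMap_counit]
  rw [Algebra.algebraMap_eq_smul_one, map_smul, antipode_one]

end antipodeInv

lemma coassoc4 :
    LinearMap.lTensor H (TensorProduct.assoc k H H H).symm.toLinearMap ∘ₗ
      (TensorProduct.assoc k H H (H ⊗[k] H)).toLinearMap ∘ₗ TensorProduct.map comul comul ∘ₗ comul =
    TensorProduct.map .id (TensorProduct.map (comul (R := k)) (.id (M := H)) ∘ₗ comul) ∘ₗ comul := by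
  simp only [coassoc_simps]

lemma coassoc5 :
    TensorProduct.map (comul (R := k) (A := H)) (TensorProduct.map .id comul ∘ₗ comul) ∘ₗ comul =
    (TensorProduct.assoc k H H (H ⊗[k] (H ⊗[k] H))).symm.toLinearMap ∘ₗ
      TensorProduct.map .id (TensorProduct.map .id (TensorProduct.assoc k H H H).toLinearMap ∘ₗ
        (TensorProduct.assoc k H (H ⊗[k] H) H).toLinearMap) ∘ₗ
      TensorProduct.map .id
        (TensorProduct.map (TensorProduct.map .id comul ∘ₗ comul) .id ∘ₗ comul) ∘ₗ comul := by
  simp only [coassoc_simps]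

/-- `Δ(S(h)) = ∑ S(h₂) ⊗ S(h₁)` -/
lemma comul_antipode (h : H) : comul (R := k) (antipode k h) =
    TensorProduct.map (antipode k) (antipode k) (TensorProduct.comm k H H (comul h)) := by
  let G : H →ₗ[k] H ⊗[k] H := TensorProduct.map (antipode k) (antipode k) ∘ₗ
    (TensorProduct.comm k H H).toLinearMap ∘ₗ comul
  suffices hs : toConv (comul ∘ₗ antipode k) = toConv G from
    LinearMap.congr_fun (toConv_injective hs) h
  symm
  apply left_inv_eq_right_inv (a := toConv (comul (R := k) (A := H))) _ LinearMap.comul_right_inv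
  let F : H ⊗[k] ((H ⊗[k] H) ⊗[k] H) →ₗ[k] H ⊗[k] H :=
    TensorProduct.map .id (LinearMap.mul' k H) ∘ₗ
    (TensorProduct.leftComm k H H H).toLinearMap ∘ₗ
    TensorProduct.map (antipode k)
      (TensorProduct.map (LinearMap.mul' k H ∘ₗ LinearMap.rTensor H (antipode k)) .id)
  have hF : LinearMap.mul' k (H ⊗[k] H) ∘ₗ
      TensorProduct.map (TensorProduct.map (antipode k) (antipode k) ∘ₗ
        (TensorProduct.comm k H H).toLinearMap) .id =
      F ∘ₗ LinearMap.lTensor H (TensorProduct.assoc k H H H).symm.toLinearMap ∘ₗ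
      (TensorProduct.assoc k H H (H ⊗[k] H)).toLinearMap := by
    ext p q r s
    simp [F]
  have h4 := coassoc4 k H
  ext h
  have e1 : (toConv G * toConv (comul (R := k) (A := H))) h =
      (LinearMap.mul' k (H ⊗[k] H) ∘ₗ TensorProduct.map (TensorProduct.map (antipode k) (antipode k)
        ∘ₗ (TensorProduct.comm k H H).toLinearMap) .id)
        (TensorProduct.map comul comul (comul h)) := by
    rw [← LinearMap.comp_apply, LinearMap.comp_assoc, ← TensorProduct.map_comp]
    rfl
  rw [e1, hF]
  have h4' := LinearMap.congr_fun h4 h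
  simp only [LinearMap.comp_apply] at h4' ⊢
  rw [h4', ← (ℛ k h).eq]
  have hq : ∀ q : H, LinearMap.mul' k H (LinearMap.rTensor H (antipode k) (comul q)) =
      algebraMap k H (counit q) := mul_antipode_rTensor_comul_apply
  have key : ∀ p q : H, F (p ⊗ₜ (TensorProduct.map comul .id (comul (R := k) q))) =
      1 ⊗ₜ (antipode k p * q) := by
    intro p q
    have hc := sum_counit_smul (R := k) (ℛ k q)
    conv_lhs => rw [← (ℛ k q).eq]
    simp only [map_sum, TensorProduct.tmul_sum, TensorProduct.map_tmul, F, LinearMap.comp_apply,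
      hq, LinearMap.id_apply, LinearEquiv.coe_coe, TensorProduct.leftComm_tmul,
      LinearMap.mul'_apply]
    conv_rhs => rw [← hc]
    simp only [Finset.mul_sum, TensorProduct.tmul_sum, Algebra.algebraMap_eq_smul_one,
      mul_smul_comm, TensorProduct.smul_tmul]
  simp only [map_sum, TensorProduct.map_tmul, LinearMap.comp_apply, LinearMap.id_apply, key]
  rw [← TensorProduct.tmul_sum, sum_antipode_mul_eq_algebraMap_counit]
  simp [Algebra.TensorProduct.one_def, Algebra.algebraMap_eq_smul_one]

variable [BijectiveAntipode k H] in
/-- `Δ(S⁻¹(h)) = ∑ S⁻¹(h₂) ⊗ S⁻¹(h₁)` -/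
lemma comul_antipodeInv (h : H) : comul (R := k) (antipodeInv k H h) =
    TensorProduct.map (antipodeInv k H) (antipodeInv k H)
      (TensorProduct.comm k H H (comul h)) := by
  have h1 := comul_antipode k H (antipodeInv k H h)
  rw [antipode_antipodeInv] at h1
  rw [h1]
  generalize comul (R := k) (antipodeInv k H h) = t
  induction t with
  | zero => simp
  | add t₁ t₂ h₁ h₂ => simp only [map_add, ← h₁, ← h₂]
  | tmul p q => simp


section DoubleAlgebra

variable [BijectiveAntipode k H]

variable {k H} in
/-- `coadj p r f = p ⇀ f ↼ S⁻¹(r)`, the functional `b ↦ ⟨f, S⁻¹(r) b p⟩`. -/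
def coadj (p r : H) : DualAlg k H →ₗ[k] DualAlg k H where
  toFun f := toConv (f.ofConv ∘ₗ LinearMap.mulLeft k (antipodeInv k H r) ∘ₗ LinearMap.mulRight k p)
  map_add' f g := by ext; simp
  map_smul' c f := by ext; simp

variable {k H} in
@[simp] lemma coadj_apply (p r : H) (f : DualAlg k H) (b : H) :
    coadj p r f b = f (antipodeInv k H r * (b * p)) := rfl

/-- The map `p ⊗ r ↦ (f ↦ p ⇀ f ↼ S⁻¹(r))`. -/
def coadjLin : H ⊗[k] H →ₗ[k] DualAlg k H →ₗ[k] DualAlg k H :=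
  TensorProduct.lift (LinearMap.mk₂ k coadj
    (fun p p' r => by ext; simp [mul_add]) (fun c p r => by ext; simp)
    (fun p r r' => by ext; simp [add_mul]) (fun c p r => by ext; simp))

variable {k H} in
@[simp] lemma coadjLin_tmul (p r : H) : coadjLin k H (p ⊗ₜ r) = coadj p r := rfl

/-- `p ⊗ (q ⊗ r) ↦ (p ⊗ r) ⊗ q` -/
def perm : H ⊗[k] (H ⊗[k] H) →ₗ[k] (H ⊗[k] H) ⊗[k] H :=
  (TensorProduct.assoc k H H H).symm.toLinearMap ∘ₗ
    TensorProduct.map .id (TensorProduct.comm k H H).toLinearMap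

variable {k H} in
@[simp] lemma perm_tmul (p q r : H) : perm k H (p ⊗ₜ (q ⊗ₜ r)) = (p ⊗ₜ r) ⊗ₜ q := rfl

/-- `twist h f = ∑ (h₁ ⇀ f ↼ S⁻¹(h₃)) ⊗ h₂` -/
def twist : H →ₗ[k] DualAlg k H →ₗ[k] DualAlg k H ⊗[k] H :=
  LinearMap.mk₂ k
    (fun h f => TensorProduct.map ((coadjLin k H).flip f) .id (perm k H (comul₃ k H h)))
    (fun h h' f => by simp) (fun c h f => by simp)
    (fun h f f' => by simp [TensorProduct.map_add_left])
    (fun c h f => by simp [TensorProduct.map_smul_left])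

lemma twist_apply (h : H) (f : DualAlg k H) :
    twist k H h f = TensorProduct.map ((coadjLin k H).flip f) .id (perm k H (comul₃ k H h)) := rfl

/-- The multiplication of the Drinfel'd double:
`(g ⊗ h) (f ⊗ l) = ∑ g (h₁ ⇀ f ↼ S⁻¹(h₃)) ⊗ h₂ l`. -/
def doubleMul : DualAlg k H ⊗[k] H →ₗ[k] DualAlg k H ⊗[k] H →ₗ[k] DualAlg k H ⊗[k] H :=
  TensorProduct.lift
    ((LinearMap.llcomp k (DualAlg k H ⊗[k] H) (DualAlg k H ⊗[k] H) (DualAlg k H ⊗[k] H) ∘ₗ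
        LinearMap.rTensorHom H ∘ₗ LinearMap.mul k (DualAlg k H)).compl₂
      (TensorProduct.uncurry (.id k) (DualAlg k H) H (DualAlg k H ⊗[k] H) ∘ₗ
        LinearMap.llcomp k (DualAlg k H) (DualAlg k H ⊗[k] H) (H →ₗ[k] DualAlg k H ⊗[k] H)
          (LinearMap.lTensorHom (DualAlg k H) ∘ₗ (LinearMap.mul k H).flip).flip ∘ₗ
        twist k H))

variable {k H}

lemma doubleMul_tmul (g f : DualAlg k H) (h l : H) :
    doubleMul k H (g ⊗ₜ h) (f ⊗ₜ l) =
      TensorProduct.map (LinearMap.mulLeft k g) (LinearMap.mulRight k l) (twist k H h f) := by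
  have : doubleMul k H (g ⊗ₜ h) (f ⊗ₜ l) = LinearMap.rTensor H (LinearMap.mulLeft k g)
    (LinearMap.lTensor (DualAlg k H) (LinearMap.mulRight k l) (twist k H h f)) := rfl
  rw [this, ← LinearMap.comp_apply, LinearMap.rTensor_comp_lTensor]

lemma coadj_mul (p p' r r' : H) (f : DualAlg k H) :
    coadj (p * p') (r * r') f = coadj p r (coadj p' r' f) := by
  ext b; simp [antipodeInv_mul, mul_assoc]

lemma twist_mul (h h' : H) (f : DualAlg k H) :
    twist k H (h * h') f = doubleMul k H (1 ⊗ₜ h) (twist k H h' f) := by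
  rw [twist_apply, twist_apply k H h', map_mul]
  generalize comul₃ k H h' = t
  induction t with
  | zero => simp
  | add t t' ht ht' => simp only [mul_add, map_add, ht, ht']
  | tmul p' w =>
    induction w with
    | zero => simp
    | add t t' ht ht' => simp only [mul_add, map_add, ht, ht', TensorProduct.tmul_add]
    | tmul q' r' =>
      simp only [perm_tmul, TensorProduct.map_tmul, LinearMap.flip_apply, coadjLin_tmul,
        LinearMap.id_apply, doubleMul_tmul]
      rw [twist_apply]
      generalize comul₃ k H h = t
      induction t with
      | zero => simp
      | add t t' ht ht' => simp only [add_mul, map_add, ht, ht']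
      | tmul p w =>
        induction w with
        | zero => simp
        | add t t' ht ht' => simp only [add_mul, map_add, ht, ht', TensorProduct.tmul_add]
        | tmul q r => simp [coadj_mul]

lemma twist_mul' (h : H) (f f' : DualAlg k H) :
    twist k H h (f * f') = doubleMul k H (twist k H h f) (f' ⊗ₜ 1) := by
  let P : (H ⊗[k] H) ⊗[k] (H ⊗[k] (H ⊗[k] H)) →ₗ[k] DualAlg k H ⊗[k] H :=
    TensorProduct.map (LinearMap.mul' k (DualAlg k H) ∘ₗ
      TensorProduct.map ((coadjLin k H).flip f) ((coadjLin k H).flip f') ∘ₗ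
      (TensorProduct.tensorTensorTensorComm k H H H H).toLinearMap ∘ₗ
      TensorProduct.map .id (TensorProduct.comm k H H).toLinearMap) .id ∘ₗ
    (TensorProduct.assoc k (H ⊗[k] H) (H ⊗[k] H) H).symm.toLinearMap ∘ₗ
    TensorProduct.map .id (TensorProduct.comm k H (H ⊗[k] H)).toLinearMap
  have hP : ∀ p₁ p₂ q r₁ r₂ : H, P ((p₁ ⊗ₜ p₂) ⊗ₜ (q ⊗ₜ (r₁ ⊗ₜ r₂))) =
      (coadj p₁ r₂ f * coadj p₂ r₁ f') ⊗ₜ q := fun _ _ _ _ _ => rfl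
  have hL : ∀ t : H ⊗[k] (H ⊗[k] H),
      TensorProduct.map ((coadjLin k H).flip (f * f')) .id (perm k H t) =
        P (TensorProduct.map comul (TensorProduct.map .id comul) t) := by
    intro t
    induction t with
    | zero => simp
    | add t t' ht ht' => simp only [map_add, ht, ht']
    | tmul p w =>
      induction w with
      | zero => simp
      | add t t' ht ht' => simp only [map_add, ht, ht', TensorProduct.tmul_add]
      | tmul q r =>
        simp only [perm_tmul, TensorProduct.map_tmul, LinearMap.flip_apply, coadjLin_tmul,
          LinearMap.id_apply]
        rw [← (ℛ k p).eq, ← (ℛ k r).eq]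
        simp only [TensorProduct.sum_tmul, TensorProduct.tmul_sum, map_sum, hP]
        simp only [← TensorProduct.sum_tmul]
        congr 1
        ext b
        change (f * f') (antipodeInv k H r * (b * p)) = _
        rw [LinearMap.convMul_apply, Bialgebra.comul_mul, Bialgebra.comul_mul, comul_antipodeInv,
          ← (ℛ k p).eq, ← (ℛ k r).eq, ← (ℛ k b).eq]
        simp only [WithConv.ofConv_sum, LinearMap.sum_apply, LinearMap.convMul_apply]
        rw [← (ℛ k b).eq]
        simp only [map_sum, Finset.sum_mul, Finset.mul_sum, TensorProduct.map_tmul,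
          TensorProduct.comm_tmul, Algebra.TensorProduct.tmul_mul_tmul, LinearMap.mul'_apply,
          coadj_apply]
        symm
        rw [Finset.sum_comm]
        exact Finset.sum_congr rfl fun _ _ => Finset.sum_comm
  have hR : ∀ t : H ⊗[k] (H ⊗[k] H),
      doubleMul k H (TensorProduct.map ((coadjLin k H).flip f) .id (perm k H t)) (f' ⊗ₜ 1) =
        P ((TensorProduct.assoc k H H (H ⊗[k] (H ⊗[k] H))).symm.toLinearMap
          (TensorProduct.map .id (TensorProduct.map .id (TensorProduct.assoc k H H H).toLinearMap ∘ₗ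
            (TensorProduct.assoc k H (H ⊗[k] H) H).toLinearMap)
            (TensorProduct.map .id (TensorProduct.map (comul₃ k H).toLinearMap .id) t))) := by
    intro t
    induction t with
    | zero => simp
    | add t t' ht ht' => simp only [map_add, LinearMap.add_apply, ht, ht']
    | tmul p w =>
      induction w with
      | zero => simp
      | add t t' ht ht' =>
        simp only [map_add, ht, ht', TensorProduct.tmul_add, LinearMap.add_apply]
      | tmul q r =>
        simp only [perm_tmul, TensorProduct.map_tmul, LinearMap.flip_apply, coadjLin_tmul,
          LinearMap.id_apply, doubleMul_tmul, LinearMap.mulRight_one, AlgHom.toLinearMap_apply,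
          twist_apply]
        generalize comul₃ k H q = w
        induction w with
        | zero => simp
        | add t t' ht ht' =>
          simp only [map_add, ht, ht', TensorProduct.tmul_add, TensorProduct.add_tmul]
        | tmul q₁ w =>
          induction w with
          | zero => simp
          | add t t' ht ht' =>
            simp only [map_add, ht, ht', TensorProduct.tmul_add, TensorProduct.add_tmul]
          | tmul q₂ q₃ => rfl
  have h5 := LinearMap.congr_fun (coassoc5 k H) h
  rw [twist_apply, twist_apply, hL, hR]
  congr 1
  have c3 : comul₃ k H h = TensorProduct.map .id comul (comul h) := rfl
  rw [c3, map_map_apply, map_map_apply (f := .id) (f' := .id)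
    (g := TensorProduct.map (comul₃ k H).toLinearMap .id)]
  exact h5

lemma twist_one (f : DualAlg k H) : twist k H 1 f = f ⊗ₜ 1 := by
  have : comul₃ k H 1 = 1 ⊗ₜ (1 ⊗ₜ 1) := by rw [map_one]; rfl
  rw [twist_apply, this]
  simp only [perm_tmul, TensorProduct.map_tmul, LinearMap.flip_apply, coadjLin_tmul,
        LinearMap.id_apply]
  congr 1
  ext b; simp

lemma counit_antipodeInv (h : H) : counit (R := k) (antipodeInv k H h) = counit (R := k) h := by
  rw [← counit_antipode (R := k) (antipodeInv k H h), antipode_antipodeInv]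

lemma sum_smul_counit {C : Type*} [AddCommGroup C] [Module k C] [Coalgebra k C] {ι : Type*} {c : C}
    (r : Coalgebra.Repr k c ι) :
    ∑ i ∈ r.index, counit (R := k) (r.right i) • r.left i = c := by
  have := congrArg (TensorProduct.rid k C) (sum_tmul_counit_eq r)
  simpa only [map_sum, TensorProduct.rid_tmul, one_smul] using this

lemma twist_one' (h : H) : twist k H h 1 = 1 ⊗ₜ h := by
  have h1 : ∀ p r : H, coadj p r (1 : DualAlg k H) =
      (counit (R := k) p * counit (R := k) r) • 1 := by
    intro p r
    ext b
    simp [counit_antipodeInv]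
    ring
  have c3 : comul₃ k H h = TensorProduct.map .id comul (comul h) := rfl
  have h2 : ∀ p q : H, TensorProduct.map ((coadjLin k H).flip 1) .id
      (perm k H (p ⊗ₜ (comul q))) = 1 ⊗ₜ (counit (R := k) p • q) := by
    intro p q
    rw [← (ℛ k q).eq]
    simp only [TensorProduct.tmul_sum, map_sum, perm_tmul, TensorProduct.map_tmul,
      LinearMap.flip_apply, coadjLin_tmul, h1, LinearMap.id_apply]
    conv_rhs => rw [← sum_smul_counit (ℛ k q)]
    simp only [Finset.smul_sum, TensorProduct.tmul_sum, mul_smul, TensorProduct.smul_tmul]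
    exact Finset.sum_congr rfl fun i _ => by rw [smul_comm]
  rw [twist_apply, c3, ← (ℛ k h).eq]
  simp only [map_sum, TensorProduct.map_tmul, LinearMap.id_apply, h2]
  rw [← TensorProduct.tmul_sum, sum_counit_smul]

lemma doubleMul_one (u : DualAlg k H ⊗[k] H) : doubleMul k H u (1 ⊗ₜ 1) = u := by
  induction u with
  | zero => simp
  | add u v hu hv => rw [map_add, LinearMap.add_apply, hu, hv]
  | tmul g h => simp [doubleMul_tmul, twist_one']

lemma one_doubleMul (u : DualAlg k H ⊗[k] H) : doubleMul k H (1 ⊗ₜ 1) u = u := by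
  induction u with
  | zero => simp
  | add u v hu hv => rw [map_add, hu, hv]
  | tmul g h => simp [doubleMul_tmul, twist_one]

lemma mulLeft_doubleMul (g : DualAlg k H) (u v : DualAlg k H ⊗[k] H) :
    doubleMul k H (TensorProduct.map (LinearMap.mulLeft k g) .id u) v =
      TensorProduct.map (LinearMap.mulLeft k g) .id (doubleMul k H u v) := by
  induction u with
  | zero => simp
  | add u w hu hw => simp only [map_add, LinearMap.add_apply, hu, hw]
  | tmul g' h =>
    induction v with
    | zero => simp
    | add u w hu hw => simp only [map_add, hu, hw]
    | tmul f l =>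
      simp only [TensorProduct.map_tmul, doubleMul_tmul, LinearMap.id_apply]
      rw [map_map_apply]
      simp [LinearMap.mulLeft_mul]

lemma doubleMul_mulRight (l : H) (u v : DualAlg k H ⊗[k] H) :
    doubleMul k H u (TensorProduct.map .id (LinearMap.mulRight k l) v) =
      TensorProduct.map .id (LinearMap.mulRight k l) (doubleMul k H u v) := by
  induction u with
  | zero => simp
  | add u w hu hw => simp only [map_add, LinearMap.add_apply, hu, hw]
  | tmul g' h =>
    induction v with
    | zero => simp
    | add u w hu hw => simp only [map_add, hu, hw]
    | tmul f l =>
      simp only [TensorProduct.map_tmul, doubleMul_tmul, LinearMap.id_apply]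
      rw [map_map_apply]
      simp [LinearMap.mulRight_mul]

lemma mulRight_doubleMul (l : H) (e : DualAlg k H) (u : DualAlg k H ⊗[k] H) :
    doubleMul k H (TensorProduct.map .id (LinearMap.mulRight k l) u) (e ⊗ₜ 1) =
      doubleMul k H u (twist k H l e) := by
  induction u with
  | zero => simp
  | add u w hu hw => simp only [map_add, LinearMap.add_apply, hu, hw]
  | tmul g h =>
    have e1 : g ⊗ₜ[k] h = TensorProduct.map (LinearMap.mulLeft k g) .id (1 ⊗ₜ h) := by simp
    rw [e1, mulLeft_doubleMul, ← twist_mul]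
    simp [doubleMul_tmul]

lemma doubleMul_mulLeft (f : DualAlg k H) (u w : DualAlg k H ⊗[k] H) :
    doubleMul k H u (TensorProduct.map (LinearMap.mulLeft k f) .id w) =
      doubleMul k H (doubleMul k H u (f ⊗ₜ 1)) w := by
  induction u with
  | zero => simp
  | add u w hu hw => simp only [map_add, LinearMap.add_apply, hu, hw]
  | tmul g h =>
    induction w with
    | zero => simp
    | add u w hu hw => simp only [map_add, hu, hw]
    | tmul e l =>
      have e1 : e ⊗ₜ[k] l = TensorProduct.map .id (LinearMap.mulRight k l) (e ⊗ₜ 1) := by simp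
      have e2 : doubleMul k H (g ⊗ₜ h) (f ⊗ₜ 1) =
          TensorProduct.map (LinearMap.mulLeft k g) .id (twist k H h f) := by
        simp [doubleMul_tmul]
      rw [e2, mulLeft_doubleMul, e1, doubleMul_mulRight, ← twist_mul', map_map_apply, map_map_apply]
      simp [doubleMul_tmul]

lemma doubleMul_assoc (u v w : DualAlg k H ⊗[k] H) :
    doubleMul k H (doubleMul k H u v) w = doubleMul k H u (doubleMul k H v w) := by
  induction u with
  | zero => simp
  | add u w hu hw => simp only [map_add, LinearMap.add_apply, hu, hw]
  | tmul g h =>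
  induction v with
  | zero => simp
  | add u w hu hw => simp only [map_add, LinearMap.add_apply, hu, hw]
  | tmul f l =>
  induction w with
  | zero => simp
  | add u w hu hw => simp only [map_add, hu, hw]
  | tmul e m =>
    have split : ∀ (a : DualAlg k H) (b : H) (t : DualAlg k H ⊗[k] H),
        TensorProduct.map (LinearMap.mulLeft k a) (LinearMap.mulRight k b) t =
        TensorProduct.map (LinearMap.mulLeft k a) .id
          (TensorProduct.map .id (LinearMap.mulRight k b) t) := by
      intro a b t
      rw [map_map_apply]; simp
    have e1 : e ⊗ₜ[k] m = TensorProduct.map .id (LinearMap.mulRight k m) (e ⊗ₜ 1) := by simp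
    rw [doubleMul_tmul g, doubleMul_tmul f, split, split, mulLeft_doubleMul, e1,
      doubleMul_mulRight, mulRight_doubleMul, doubleMul_mulLeft, doubleMul_mulRight,
      doubleMul_tmul g, LinearMap.mulRight_one, mulLeft_doubleMul]
    simp only [map_map_apply, LinearMap.comp_id, LinearMap.id_comp]

variable (k H)

/-- The Drinfel'd double `D(H)`, with underlying space `H^* ⊗ H`. -/
def DrinfeldDouble := DualAlg k H ⊗[k] H

namespace DrinfeldDouble

instance : AddCommGroup (DrinfeldDouble k H) :=
  inferInstanceAs (AddCommGroup (DualAlg k H ⊗[k] H))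

instance : Module k (DrinfeldDouble k H) := inferInstanceAs (Module k (DualAlg k H ⊗[k] H))

variable {k H} in
/-- The element `f ⊗ h` of `D(H)`. -/
def tmul (f : DualAlg k H) (h : H) : DrinfeldDouble k H := f ⊗ₜ[k] h

/-- The algebra structure: `(g ⊗ h) (f ⊗ l) = ∑ g (h₁ ⇀ f ↼ S⁻¹(h₃)) ⊗ h₂ l`, with unit
`ε ⊗ 1`. -/
instance : Ring (DrinfeldDouble k H) where
  __ := (inferInstance : AddCommGroup (DrinfeldDouble k H))
  mul u v := doubleMul k H u v
  one := tmul 1 1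
  left_distrib u v w := (doubleMul k H u).map_add v w
  right_distrib u v w := LinearMap.map_add₂ (doubleMul k H) u v w
  zero_mul u := LinearMap.map_zero₂ (doubleMul k H) u
  mul_zero u := (doubleMul k H u).map_zero
  mul_assoc := doubleMul_assoc
  one_mul := one_doubleMul
  mul_one := doubleMul_one

instance : Algebra k (DrinfeldDouble k H) :=
  Algebra.ofModule (fun c u v => LinearMap.map_smul₂ (doubleMul k H) c u v)
    (fun c u v => (doubleMul k H u).map_smul c v)


variable {k H}

lemma mul_def (u v : DrinfeldDouble k H) : u * v = doubleMul k H u v := rfl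

lemma one_def : (1 : DrinfeldDouble k H) = tmul 1 1 := rfl

lemma tmul_mul_tmul_one (f f' : DualAlg k H) (h : H) :
    (tmul f 1 : DrinfeldDouble k H) * tmul f' h = tmul (f * f') h := by
  change doubleMul k H (f ⊗ₜ 1) (f' ⊗ₜ h) = _
  rw [doubleMul_tmul, twist_one]
  simp [tmul]

lemma tmul_mul_one_tmul (f : DualAlg k H) (h h' : H) :
    (tmul f h : DrinfeldDouble k H) * tmul 1 h' = tmul f (h * h') := by
  change doubleMul k H (f ⊗ₜ h) (1 ⊗ₜ h') = _
  rw [doubleMul_tmul, twist_one']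
  simp [tmul]

lemma one_tmul_mul (h : H) (f : DualAlg k H) :
    (tmul 1 h : DrinfeldDouble k H) * tmul f 1 = twist k H h f := by
  change doubleMul k H (1 ⊗ₜ h) (f ⊗ₜ 1) = _
  rw [doubleMul_tmul]
  simp

variable (k H) in
/-- The embedding `h ↦ ε ⊗ h` of `H` into `D(H)`. -/
def inclRight : H →ₐ[k] DrinfeldDouble k H :=
  AlgHom.ofLinearMap (TensorProduct.mk k (DualAlg k H) H 1) rfl
    (fun h h' => (tmul_mul_one_tmul 1 h h').symm)

variable (k H) in
/-- The embedding `f ↦ f ⊗ 1` of `H^*` into `D(H)`. -/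
def inclLeft : DualAlg k H →ₐ[k] DrinfeldDouble k H :=
  AlgHom.ofLinearMap ((TensorProduct.mk k (DualAlg k H) H).flip 1) rfl
    (fun f f' => (tmul_mul_tmul_one f f' 1).symm)

lemma inclRight_apply (h : H) : inclRight k H h = tmul 1 h := rfl

lemma inclLeft_apply (f : DualAlg k H) : inclLeft k H f = tmul f 1 := rfl

lemma inclLeft_mul_inclRight (f : DualAlg k H) (h : H) :
    inclLeft k H f * inclRight k H h = tmul f h := by
  rw [inclLeft_apply, inclRight_apply, tmul_mul_tmul_one, mul_one]

@[elab_as_elim]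
lemma induction {P : DrinfeldDouble k H → Prop} (h0 : P 0) (ht : ∀ f h, P (tmul f h))
    (ha : ∀ u v, P u → P v → P (u + v)) (u : DrinfeldDouble k H) : P u :=
  TensorProduct.induction_on (motive := P) u h0 ht ha

end DrinfeldDouble

end DoubleAlgebra



section YD

variable {k H}
variable {V : Type*} [AddCommGroup V] [Module k V]

lemma exists_trilinear (F : H → H → H → V) (h₁ : ∀ q r, IsLinearMap k fun p => F p q r)
    (h₂ : ∀ p r, IsLinearMap k fun q => F p q r) (h₃ : ∀ p q, IsLinearMap k fun r => F p q r) :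
    ∃ B : H ⊗[k] (H ⊗[k] H) →ₗ[k] V, ∀ p q r, B (p ⊗ₜ (q ⊗ₜ r)) = F p q r := by
  refine ⟨lift₃ (LinearMap.mk₂ k (fun p q => (h₃ p q).mk') ?_ ?_ ?_ ?_), fun p q r => rfl⟩
  · intro p p' q; ext r; exact (h₁ q r).map_add p p'
  · intro c p q; ext r; exact (h₁ q r).map_smul c p
  · intro p q q'; ext r; exact (h₂ p r).map_add q q'
  · intro c p q; ext r; exact (h₂ p r).map_smul c q

lemma sum_coassoc (F : H → H → H → V) (h₁ : ∀ q r, IsLinearMap k fun p => F p q r)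
    (h₂ : ∀ p r, IsLinearMap k fun q => F p q r) (h₃ : ∀ p q, IsLinearMap k fun r => F p q r)
    (h : H) :
    ∑ i ∈ (ℛ k h).index, ∑ j ∈ (ℛ k ((ℛ k h).left i)).index,
      F ((ℛ k ((ℛ k h).left i)).left j) ((ℛ k ((ℛ k h).left i)).right j) ((ℛ k h).right i) =
    ∑ i ∈ (ℛ k h).index, ∑ j ∈ (ℛ k ((ℛ k h).right i)).index,
      F ((ℛ k h).left i) ((ℛ k ((ℛ k h).right i)).left j)
        ((ℛ k ((ℛ k h).right i)).right j) := by
  obtain ⟨B, hB⟩ := exists_trilinear F h₁ h₂ h₃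
  have := congrArg B (sum_tmul_tmul_eq (ℛ k h) (fun i => ℛ k ((ℛ k h).left i))
    (fun i => ℛ k ((ℛ k h).right i)))
  simpa only [map_sum, hB] using this

lemma comul₃_eq (h : H) : comul₃ k H h =
    ∑ i ∈ (ℛ k h).index, ∑ j ∈ (ℛ k ((ℛ k h).right i)).index,
      (ℛ k h).left i ⊗ₜ[k] ((ℛ k ((ℛ k h).right i)).left j ⊗ₜ[k]
        (ℛ k ((ℛ k h).right i)).right j) := by
  have c3 : comul₃ k H h = TensorProduct.map .id comul (comul h) := rfl
  conv_lhs => rw [c3, ← (ℛ k h).eq]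
  simp only [map_sum, TensorProduct.map_tmul, LinearMap.id_apply]
  refine Finset.sum_congr rfl fun i _ => ?_
  rw [← TensorProduct.tmul_sum, (ℛ k ((ℛ k h).right i)).eq]

variable (k H)

/-- A left-right Yetter-Drinfel'd module structure over `H` on the vector space `M`: a left
`H`-module structure and a right `H`-comodule structure such that
`∑ h₁ m₀ ⊗ h₂ m₁ = ∑ (h₂ m)₀ ⊗ (h₂ m)₁ h₁`.
(Here `ℛ k h` is a representation `Δ(h) = ∑ left ⊗ right`; both sums are independent of it.) -/
structure YetterDrinfeld (M : Type*) [AddCommGroup M] [Module k M] where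
  act : H →ₐ[k] Module.End k M
  coact : M →ₗ[k] M ⊗[k] H
  coassoc : (TensorProduct.assoc k M H H).toLinearMap ∘ₗ coact.rTensor H ∘ₗ coact =
    LinearMap.lTensor M comul ∘ₗ coact
  counit_coact : (TensorProduct.rid k M).toLinearMap ∘ₗ LinearMap.lTensor M counit ∘ₗ coact = .id
  compat : ∀ (h : H) (m : M),
    ∑ i ∈ (ℛ k h).index,
      TensorProduct.map (act ((ℛ k h).left i)) (LinearMap.mulLeft k ((ℛ k h).right i)) (coact m) =
    ∑ i ∈ (ℛ k h).index,
      TensorProduct.map .id (LinearMap.mulRight k ((ℛ k h).left i))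
        (coact (act ((ℛ k h).right i) m))

variable {k H}

namespace YetterDrinfeld

variable {M : Type*} [AddCommGroup M] [Module k M] {N : Type*} [AddCommGroup N] [Module k N]

/-- Isomorphy of Yetter-Drinfel'd modules. -/
def IsIso (V : YetterDrinfeld k H M) (W : YetterDrinfeld k H N) : Prop :=
  ∃ φ : M ≃ₗ[k] N, (∀ h m, φ (V.act h m) = W.act h (φ m)) ∧
    ∀ m, W.coact (φ m) = LinearMap.rTensor H φ.toLinearMap (V.coact m)

/-- The pairing `f ↦ ∑ ⟨f, m₁⟩ m₀` for `t = ∑ m₀ ⊗ m₁`. -/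
def pair : DualAlg k H →ₗ[k] M ⊗[k] H →ₗ[k] M where
  toFun f := (TensorProduct.rid k M).toLinearMap ∘ₗ LinearMap.lTensor M f.ofConv
  map_add' f g := by ext; simp
  map_smul' c f := by ext; simp

@[simp] lemma pair_tmul (f : DualAlg k H) (m : M) (h : H) : pair f (m ⊗ₜ[k] h) = f h • m := rfl

lemma pair_map (f : DualAlg k H) (g : M →ₗ[k] N) (l : H →ₗ[k] H) (t : M ⊗[k] H) :
    pair f (TensorProduct.map g l t) = g (pair (toConv (f.ofConv ∘ₗ l)) t) := by
  induction t with
  | zero => simp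
  | add t t' ht ht' => simp only [map_add, ht, ht']
  | tmul m h => simp

lemma pair_pair_rTensor (c : M →ₗ[k] M ⊗[k] H) (f g : DualAlg k H) (t : M ⊗[k] H) :
    pair f (pair g (c.rTensor H t)) = pair f (c (pair g t)) := by
  induction t with
  | zero => simp
  | add t t' ht ht' => simp only [map_add, ht, ht']
  | tmul m h => simp

lemma pair_convMul (f g : DualAlg k H) (t : M ⊗[k] H) :
    pair (f * g) t =
      pair f (pair g ((TensorProduct.assoc k M H H).symm (LinearMap.lTensor M comul t))) := by
  induction t with
  | zero => simp
  | add t t' ht ht' => simp only [map_add, ht, ht']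
  | tmul m h =>
    simp only [pair_tmul, LinearMap.lTensor_tmul, LinearMap.convMul_apply]
    rw [← (ℛ k h).eq]
    simp only [map_sum, TensorProduct.map_tmul, LinearMap.mul'_apply, Finset.sum_smul,
      TensorProduct.tmul_sum, TensorProduct.assoc_symm_tmul, pair_tmul, map_smul]
    exact Finset.sum_congr rfl fun i _ => by rw [mul_comm, mul_smul]

/-- The action `f · m = ∑ ⟨f, m₁⟩ m₀` of `H^*`. -/
def dualAct (V : YetterDrinfeld k H M) : DualAlg k H →ₐ[k] Module.End k M :=
  AlgHom.ofLinearMap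
    { toFun := fun f => pair f ∘ₗ V.coact
      map_add' := fun f g => by ext; simp
      map_smul' := fun c f => by ext; simp }
    (by
      ext m
      exact LinearMap.congr_fun V.counit_coact m)
    (by
      intro f g
      ext m
      have h1 := LinearMap.congr_fun V.coassoc m
      change pair (f * g) (V.coact m) = pair f (V.coact (pair g (V.coact m)))
      simp only [LinearMap.comp_apply, LinearEquiv.coe_coe] at h1
      rw [← pair_pair_rTensor, pair_convMul, ← h1, LinearEquiv.symm_apply_apply])

lemma dualAct_apply (V : YetterDrinfeld k H M) (f : DualAlg k H) (m : M) :
    V.dualAct f m = pair f (V.coact m) := rfl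

section

variable [BijectiveAntipode k H]

lemma lift_twist (V : YetterDrinfeld k H M) (h : H) (f : DualAlg k H) (m : M) :
    TensorProduct.lift ((LinearMap.mul k (Module.End k M)).compl₁₂ V.dualAct.toLinearMap
        V.act.toLinearMap) (twist k H h f) m =
    ∑ i ∈ (ℛ k h).index, ∑ j ∈ (ℛ k ((ℛ k h).right i)).index,
      pair (coadj ((ℛ k h).left i) ((ℛ k ((ℛ k h).right i)).right j) f)
        (V.coact (V.act ((ℛ k ((ℛ k h).right i)).left j) m)) := by
  rw [twist_apply, comul₃_eq]
  simp only [map_sum, LinearMap.sum_apply]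
  rfl

lemma sum_antipodeInv_smul (h : H) (f : DualAlg k H) :
    ∑ j ∈ (ℛ k h).index,
      toConv (f.ofConv ∘ₗ LinearMap.mulLeft k (antipodeInv k H ((ℛ k h).right j) * (ℛ k h).left j)) =
    counit (R := k) h • f := by
  ext b
  have := congrArg (fun u => f (u * b)) (sum_antipodeInv_mul k (ℛ k h))
  simpa [Finset.sum_mul, ← Algebra.smul_def, mul_assoc] using this

lemma act_dualAct (V : YetterDrinfeld k H M) (h : H) (f : DualAlg k H) (m : M) :
    V.act h (V.dualAct f m) =
      TensorProduct.lift ((LinearMap.mul k (Module.End k M)).compl₁₂ V.dualAct.toLinearMap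
        V.act.toLinearMap) (twist k H h f) m := by
  rw [lift_twist]
  rw [← sum_coassoc (fun p q r => pair (coadj p r f) (V.coact (V.act q m)))]
  rotate_left
  · intro q r
    have : ∀ p, coadj p r f = coadjLin k H (p ⊗ₜ r) f := fun _ => rfl
    simp only [this]
    exact ⟨fun _ _ => by simp [TensorProduct.add_tmul], fun _ _ => by
      simp [← TensorProduct.smul_tmul']⟩
  · exact fun p r => ⟨fun _ _ => by simp, fun _ _ => by simp⟩
  · intro p q
    have : ∀ r, coadj p r f = coadjLin k H (p ⊗ₜ r) f := fun _ => rfl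
    simp only [this]
    exact ⟨fun _ _ => by simp [TensorProduct.tmul_add], fun _ _ => by simp⟩
  let W : H →ₗ[k] DualAlg k H :=
    { toFun := fun x => toConv (f.ofConv ∘ₗ LinearMap.mulLeft k x)
      map_add' := fun x y => by ext; simp [add_mul]
      map_smul' := fun c x => by ext; simp }
  have e1 : ∀ i, ∑ j ∈ (ℛ k ((ℛ k h).left i)).index,
      pair (coadj ((ℛ k ((ℛ k h).left i)).left j) ((ℛ k h).right i) f)
        (V.coact (V.act ((ℛ k ((ℛ k h).left i)).right j) m)) =
      ∑ j ∈ (ℛ k ((ℛ k h).left i)).index,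
        V.act ((ℛ k ((ℛ k h).left i)).left j) (pair (W (antipodeInv k H ((ℛ k h).right i) *
          (ℛ k ((ℛ k h).left i)).right j)) (V.coact m)) := by
    intro i
    have h1 := congrArg (pair (W (antipodeInv k H ((ℛ k h).right i))))
      (V.compat ((ℛ k h).left i) m)
    simp only [map_sum, pair_map, LinearMap.id_apply] at h1
    rw [eq_comm] at h1
    refine Eq.trans rfl (h1.trans (Finset.sum_congr rfl fun j _ => ?_))
    have : toConv ((W (antipodeInv k H ((ℛ k h).right i))).ofConv ∘ₗ
        LinearMap.mulLeft k ((ℛ k ((ℛ k h).left i)).right j)) =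
        W (antipodeInv k H ((ℛ k h).right i) * (ℛ k ((ℛ k h).left i)).right j) := by
      ext b; simp [W]
    rw [this]
  simp only [e1]
  rw [sum_coassoc (fun p q r => V.act p (pair (W (antipodeInv k H r * q)) (V.coact m)))]
  rotate_left
  · exact fun q r => ⟨fun _ _ => by simp, fun _ _ => by simp⟩
  · exact fun p r => ⟨fun _ _ => by simp [mul_add], fun _ _ => by simp⟩
  · exact fun p q => ⟨fun _ _ => by simp [add_mul], fun _ _ => by simp⟩
  have e2 : ∀ i, ∑ j ∈ (ℛ k ((ℛ k h).right i)).index,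
      V.act ((ℛ k h).left i) (pair (W (antipodeInv k H ((ℛ k ((ℛ k h).right i)).right j) *
        (ℛ k ((ℛ k h).right i)).left j)) (V.coact m)) =
      V.act (counit (R := k) ((ℛ k h).right i) • (ℛ k h).left i) (pair f (V.coact m)) := by
    intro i
    rw [← map_sum, ← LinearMap.sum_apply, ← map_sum]
    have := sum_antipodeInv_smul ((ℛ k h).right i) f
    change ∑ j ∈ _, W _ = _ at this
    rw [this]
    simp
  simp only [e2]
  rw [← LinearMap.sum_apply, ← map_sum, sum_smul_counit]
  rfl

/-- The linear map `f ⊗ h ↦ (m ↦ f · (h · m))`. -/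
def doubleActLin (V : YetterDrinfeld k H M) : DrinfeldDouble k H →ₗ[k] Module.End k M :=
  TensorProduct.lift ((LinearMap.mul k (Module.End k M)).compl₁₂ V.dualAct.toLinearMap
    V.act.toLinearMap)

lemma doubleActLin_tmul (V : YetterDrinfeld k H M) (f : DualAlg k H) (h : H) :
    V.doubleActLin (.tmul f h) = V.dualAct f * V.act h := rfl

lemma doubleActLin_mul (V : YetterDrinfeld k H M) (u v : DrinfeldDouble k H) :
    V.doubleActLin (u * v) = V.doubleActLin u * V.doubleActLin v := by
  induction u using DrinfeldDouble.induction with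
  | h0 => rw [zero_mul, map_zero, zero_mul]
  | ha u u' hu hu' => rw [add_mul, map_add, map_add, add_mul, hu, hu']
  | ht g h =>
  induction v using DrinfeldDouble.induction with
  | h0 => rw [mul_zero, map_zero, mul_zero]
  | ha u u' hu hu' => rw [mul_add, map_add, map_add, mul_add, hu, hu']
  | ht f l =>
    change TensorProduct.lift ((LinearMap.mul k (Module.End k M)).compl₁₂ V.dualAct.toLinearMap
        V.act.toLinearMap) (doubleMul k H (g ⊗ₜ h) (f ⊗ₜ l)) =
      (V.dualAct g * V.act h) * (V.dualAct f * V.act l)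
    have h1 : V.act h * V.dualAct f = TensorProduct.lift
        ((LinearMap.mul k (Module.End k M)).compl₁₂ V.dualAct.toLinearMap
        V.act.toLinearMap) (twist k H h f) := LinearMap.ext fun m => V.act_dualAct h f m
    rw [mul_assoc, ← mul_assoc (V.act h), h1, doubleMul_tmul]
    generalize twist k H h f = t
    induction t with
    | zero => simp
    | add t t' ht ht' => simp only [map_add, ht, ht', add_mul, mul_add]
    | tmul f' h' => simp [mul_assoc]

/-- The action of the Drinfel'd double on a Yetter-Drinfel'd module:
`(f ⊗ h) · m = f · (h · m)`. -/
def doubleAct (V : YetterDrinfeld k H M) : DrinfeldDouble k H →ₐ[k] Module.End k M :=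
  AlgHom.ofLinearMap V.doubleActLin
    (by rw [DrinfeldDouble.one_def, doubleActLin_tmul, map_one, map_one, one_mul])
    V.doubleActLin_mul

lemma doubleAct_tmul (V : YetterDrinfeld k H M) (f : DualAlg k H) (h : H) :
    V.doubleAct (.tmul f h) = V.dualAct f * V.act h := rfl

/-- A Yetter-Drinfel'd module, regarded as a module over the Drinfel'd double. -/
def toModuleCat {M : Type*} [AddCommGroup M] [Module k M] (V : YetterDrinfeld k H M) :
    ModuleCat (DrinfeldDouble k H) :=
  letI := Module.compHom M V.doubleAct.toRingHom
  ModuleCat.of (DrinfeldDouble k H) M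

end


section ofDouble

variable [FiniteDimensional k H]

lemma ext_pair {t t' : M ⊗[k] H} (h : ∀ f : DualAlg k H, pair f t = pair f t') : t = t' := by
  let b := Module.finBasis k H
  have key : ∀ t : M ⊗[k] H, t = ∑ i, pair (toConv (b.coord i)) t ⊗ₜ[k] b i := by
    intro t
    induction t with
    | zero => simp
    | add t t' ht ht' =>
      simp only [map_add, TensorProduct.add_tmul, Finset.sum_add_distrib, ← ht, ← ht']
    | tmul m x =>
      conv_lhs => rw [← b.sum_repr x]
      simp only [TensorProduct.tmul_sum, pair_tmul, TensorProduct.tmul_smul,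
        TensorProduct.smul_tmul', Module.Basis.coord_apply]
  rw [key t, key t']
  simp only [h]

variable [BijectiveAntipode k H]

/-- The `H`-coaction on a module over the Drinfel'd double of a finite-dimensional `H`: the unique
one with `(f ⊗ 1) · m = ∑ ⟨f, m₁⟩ m₀` for all `f`. -/
def coactOfDouble (ρ : DrinfeldDouble k H →ₐ[k] Module.End k M) : M →ₗ[k] M ⊗[k] H :=
  ∑ i, (TensorProduct.mk k M H).flip (Module.finBasis k H i) ∘ₗ
    ρ (.tmul (toConv ((Module.finBasis k H).coord i)) 1)

lemma pair_coactOfDouble (ρ : DrinfeldDouble k H →ₐ[k] Module.End k M) (f : DualAlg k H) (m : M) :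
    pair f (coactOfDouble ρ m) = ρ (.tmul f 1) m := by
  have hf : f = ∑ i, f (Module.finBasis k H i) • toConv ((Module.finBasis k H).coord i) := by
    ext b
    conv_lhs => rw [← (Module.finBasis k H).sum_repr b]
    simp [WithConv.ofConv_sum]
  have hρ : ∀ f, ρ (.tmul f 1) = (ρ.comp (DrinfeldDouble.inclLeft k H)) f := fun _ => rfl
  conv_rhs => rw [hf]
  simp only [coactOfDouble, hρ, LinearMap.sum_apply, map_sum, map_smul, LinearMap.comp_apply,
    LinearMap.flip_apply, TensorProduct.mk_apply, pair_tmul, LinearMap.smul_apply]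

/-- `∑ h₁ (f ↼ h₂) = ∑ (h₁ ⇀ f) h₂` in the Drinfel'd double. -/
lemma sum_twist (f : DualAlg k H) (h : H) :
    ∑ i ∈ (ℛ k h).index, twist k H ((ℛ k h).left i)
      (toConv (f.ofConv ∘ₗ LinearMap.mulLeft k ((ℛ k h).right i))) =
    ∑ i ∈ (ℛ k h).index,
      toConv (f.ofConv ∘ₗ LinearMap.mulRight k ((ℛ k h).left i)) ⊗ₜ[k] (ℛ k h).right i := by
  let U : H →ₗ[k] H →ₗ[k] DualAlg k H := LinearMap.mk₂ k
    (fun x p => toConv (f.ofConv ∘ₗ LinearMap.mulLeft k x ∘ₗ LinearMap.mulRight k p))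
    (fun x x' p => by ext; simp [add_mul]) (fun c x p => by ext; simp)
    (fun x p p' => by ext; simp [mul_add]) (fun c x p => by ext; simp)
  let F : H → H → H → DualAlg k H ⊗[k] H := fun p w r =>
    TensorProduct.lift (LinearMap.mk₂ k
      (fun q s => U (r * antipodeInv k H s) p ⊗ₜ[k] q)
      (fun q q' s => by simp [TensorProduct.tmul_add]) (fun c q s => by simp)
      (fun q s s' => by simp [mul_add, TensorProduct.add_tmul])
      (fun c q s => by simp [TensorProduct.smul_tmul'])) (comul w)
  have hF : ∀ p w r, F p w r = ∑ j ∈ (ℛ k w).index,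
      U (r * antipodeInv k H ((ℛ k w).right j)) p ⊗ₜ[k] (ℛ k w).left j := by
    intro p w r
    change TensorProduct.lift _ (comul w) = _
    conv_lhs => rw [← (ℛ k w).eq]
    rw [map_sum]
    rfl
  have hF1 : ∀ q r, IsLinearMap k fun p => F p q r := fun q r =>
    ⟨fun _ _ => by simp [hF, TensorProduct.add_tmul, Finset.sum_add_distrib],
      fun _ _ => by simp [hF, TensorProduct.smul_tmul', Finset.smul_sum]⟩
  have hF2 : ∀ p r, IsLinearMap k fun q => F p q r := fun p r =>
    ⟨fun _ _ => by simp [F], fun _ _ => by simp [F]⟩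
  have hF3 : ∀ p q, IsLinearMap k fun r => F p q r := fun p q =>
    ⟨fun _ _ => by simp [hF, TensorProduct.add_tmul, add_mul, Finset.sum_add_distrib],
      fun _ _ => by simp [hF, TensorProduct.smul_tmul', Finset.smul_sum]⟩
  have e1 : ∀ l r : H, twist k H l (toConv (f.ofConv ∘ₗ LinearMap.mulLeft k r)) =
      ∑ i ∈ (ℛ k l).index, F ((ℛ k l).left i) ((ℛ k l).right i) r := by
    intro l r
    rw [twist_apply, comul₃_eq]
    simp only [map_sum, hF]
    refine Finset.sum_congr rfl fun i _ => Finset.sum_congr rfl fun j _ => ?_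
    simp only [perm_tmul, TensorProduct.map_tmul, LinearMap.flip_apply, coadjLin_tmul,
      LinearMap.id_apply]
    congr 1
    ext b
    simp [U]
  simp only [e1]
  rw [sum_coassoc F hF1 hF2 hF3]
  refine Finset.sum_congr rfl fun i _ => ?_
  generalize (ℛ k h).left i = p
  generalize (ℛ k h).right i = w
  simp only [hF]
  rw [sum_coassoc (fun q s r => U (r * antipodeInv k H s) p ⊗ₜ[k] q)]
  rotate_left
  · exact fun _ _ => ⟨fun _ _ => by simp [TensorProduct.tmul_add], fun _ _ => by simp⟩
  · exact fun _ _ => ⟨fun _ _ => by simp [TensorProduct.add_tmul, mul_add],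
      fun _ _ => by simp [TensorProduct.smul_tmul']⟩
  · exact fun _ _ => ⟨fun _ _ => by simp [TensorProduct.add_tmul, add_mul],
      fun _ _ => by simp [TensorProduct.smul_tmul']⟩
  have hU : U 1 p = toConv (f.ofConv ∘ₗ LinearMap.mulRight k p) := by ext b; simp [U]
  simp only [← TensorProduct.sum_tmul, ← LinearMap.sum_apply, ← map_sum, sum_mul_antipodeInv]
  simp only [Algebra.algebraMap_eq_smul_one, map_smul, LinearMap.smul_apply, hU,
    TensorProduct.smul_tmul]
  rw [← TensorProduct.tmul_sum, sum_smul_counit]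

/-- The Yetter-Drinfel'd module structure corresponding to a module over the Drinfel'd double of a
finite-dimensional Hopf algebra: the action of `H` is the restriction of that of `D(H)`, and
`(f ⊗ 1) · m = ∑ ⟨f, m₁⟩ m₀`. -/
def ofDouble (ρ : DrinfeldDouble k H →ₐ[k] Module.End k M) : YetterDrinfeld k H M where
  act := ρ.comp (DrinfeldDouble.inclRight k H)
  coact := coactOfDouble ρ
  coassoc := by
    ext m
    apply (TensorProduct.assoc k M H H).symm.injective
    refine ext_pair fun g => ext_pair fun f => ?_
    simp only [LinearMap.comp_apply, LinearEquiv.coe_coe, LinearEquiv.symm_apply_apply]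
    rw [← pair_convMul, pair_pair_rTensor]
    simp only [pair_coactOfDouble]
    rw [← Module.End.mul_apply, ← map_mul, DrinfeldDouble.tmul_mul_tmul_one]
  counit_coact := by
    ext m
    exact (pair_coactOfDouble ρ (1 : DualAlg k H) m).trans (by
      rw [← DrinfeldDouble.one_def, map_one]; rfl)
  compat h m := by
    refine ext_pair fun f => ?_
    simp only [map_sum, pair_map, pair_coactOfDouble, LinearMap.id_apply, AlgHom.comp_apply,
      DrinfeldDouble.inclRight_apply]
    simp only [← Module.End.mul_apply, ← map_mul, ← LinearMap.sum_apply, ← map_sum]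
    congr 2
    simp only [DrinfeldDouble.one_tmul_mul, DrinfeldDouble.tmul_mul_one_tmul, one_mul]
    exact sum_twist f h

lemma doubleAct_ofDouble (ρ : DrinfeldDouble k H →ₐ[k] Module.End k M) :
    (ofDouble ρ).doubleAct = ρ := by
  ext u m
  induction u using DrinfeldDouble.induction with
  | h0 => simp
  | ha u v hu hv => simp only [map_add, LinearMap.add_apply, hu, hv]
  | ht f h =>
    rw [doubleAct_tmul, Module.End.mul_apply, dualAct_apply]
    change pair f (coactOfDouble ρ (ρ (.tmul 1 h) m)) = _
    rw [pair_coactOfDouble, ← Module.End.mul_apply, ← map_mul, DrinfeldDouble.tmul_mul_one_tmul,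
      one_mul]

end ofDouble

section restrict

/-- The coaction, restricted to a stable subspace. -/
def restrictCoact (V : YetterDrinfeld k H M) (N : Submodule k M)
    (hcoact : ∀ m ∈ N, V.coact m ∈ LinearMap.range (N.subtype.rTensor H)) : N →ₗ[k] N ⊗[k] H :=
  (LinearEquiv.ofInjective (N.subtype.rTensor H)
      (Module.Flat.rTensor_preserves_injective_linearMap _ N.injective_subtype)).symm.toLinearMap ∘ₗ
    LinearMap.codRestrict _ (V.coact ∘ₗ N.subtype) (fun m => hcoact m m.2)

lemma rTensor_restrictCoact (V : YetterDrinfeld k H M) (N : Submodule k M)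
    (hcoact : ∀ m ∈ N, V.coact m ∈ LinearMap.range (N.subtype.rTensor H)) :
    N.subtype.rTensor H ∘ₗ V.restrictCoact N hcoact = V.coact ∘ₗ N.subtype := by
  ext n
  have hi : Function.Injective (N.subtype.rTensor H) :=
    Module.Flat.rTensor_preserves_injective_linearMap _ N.injective_subtype
  have := congrArg Subtype.val ((LinearEquiv.ofInjective (N.subtype.rTensor H) hi).apply_symm_apply
    (LinearMap.codRestrict _ (V.coact ∘ₗ N.subtype) (fun m => hcoact m m.2) n))
  exact this

/-- The restriction of a Yetter-Drinfel'd structure to a subspace `N` that is stable under the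
action and the coaction. -/
def restrict (V : YetterDrinfeld k H M) (N : Submodule k M)
    (hact : ∀ h, ∀ m ∈ N, V.act h m ∈ N)
    (hcoact : ∀ m ∈ N, V.coact m ∈ LinearMap.range (N.subtype.rTensor H)) :
    YetterDrinfeld k H N where
  act := AlgHom.ofLinearMap
    { toFun := fun h => (V.act h).restrict (hact h)
      map_add' := fun h h' => by ext; simp
      map_smul' := fun c h => by ext; simp }
    (by ext; simp) (fun h h' => by ext; simp)
  coact := V.restrictCoact N hcoact
  coassoc := by
    have hi : Function.Injective (N.subtype.rTensor (H ⊗[k] H)) :=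
      Module.Flat.rTensor_preserves_injective_linearMap _ N.injective_subtype
    have h1 : N.subtype.rTensor (H ⊗[k] H) ∘ₗ (TensorProduct.assoc k N H H).toLinearMap =
        (TensorProduct.assoc k M H H).toLinearMap ∘ₗ (N.subtype.rTensor H).rTensor H := by
      ext; rfl
    have h2 : N.subtype.rTensor (H ⊗[k] H) ∘ₗ LinearMap.lTensor N (comul (R := k)) =
        LinearMap.lTensor M (comul (R := k)) ∘ₗ N.subtype.rTensor H := by
      rw [LinearMap.rTensor_comp_lTensor, LinearMap.lTensor_comp_rTensor]
    have hr := V.rTensor_restrictCoact N hcoact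
    ext n
    apply hi
    have a1 := LinearMap.congr_fun h1
      ((V.restrictCoact N hcoact).rTensor H (V.restrictCoact N hcoact n))
    have a2 := LinearMap.congr_fun h2 (V.restrictCoact N hcoact n)
    have a3 := LinearMap.congr_fun hr n
    simp only [LinearMap.comp_apply, LinearEquiv.coe_coe] at a1 a2 a3 ⊢
    rw [a1, a2, a3, ← LinearMap.rTensor_comp_apply, hr, LinearMap.rTensor_comp_apply, a3]
    exact LinearMap.congr_fun V.coassoc n
  counit_coact := by
    have h1 : N.subtype ∘ₗ (TensorProduct.rid k N).toLinearMap ∘ₗ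
        LinearMap.lTensor N (counit (R := k) (A := H)) = (TensorProduct.rid k M).toLinearMap ∘ₗ
        LinearMap.lTensor M (counit (R := k)) ∘ₗ N.subtype.rTensor H := by
      ext; simp
    ext n
    have a1 := LinearMap.congr_fun h1 (V.restrictCoact N hcoact n)
    have a3 := LinearMap.congr_fun (V.rTensor_restrictCoact N hcoact) n
    refine a1.trans ?_
    simp only [LinearMap.comp_apply] at a3 ⊢
    rw [a3]
    exact LinearMap.congr_fun V.counit_coact n
  compat h m := by
    have hi : Function.Injective (N.subtype.rTensor H) :=
      Module.Flat.rTensor_preserves_injective_linearMap _ N.injective_subtype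
    have hr : ∀ m, N.subtype.rTensor H (V.restrictCoact N hcoact m) = V.coact m :=
      fun m => LinearMap.congr_fun (V.rTensor_restrictCoact N hcoact) m
    apply hi
    have h1 : ∀ (f : Module.End k N) (g : Module.End k M) (l : H →ₗ[k] H) (t : N ⊗[k] H),
        (∀ n : N, (f n : M) = g n) → N.subtype.rTensor H (TensorProduct.map f l t) =
          TensorProduct.map g l (N.subtype.rTensor H t) := by
      intro f g l t hfg
      induction t with
      | zero => simp
      | add t t' ht ht' => simp only [map_add, ht, ht']
      | tmul n h => simp [hfg]
    have := V.compat h m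
    rw [map_sum, map_sum]
    refine (Finset.sum_congr rfl fun i _ => ?_).trans (this.trans
      (Finset.sum_congr rfl fun i _ => ?_))
    · rw [h1 _ (V.act ((ℛ k h).left i)) _ _ (fun n => rfl), hr]
    · rw [h1 _ .id _ _ (fun n => rfl), hr]
      rfl

end restrict

section orbit

/-- The cyclic `H`-submodule `H · m = {h · m}`. -/
def orbit (V : YetterDrinfeld k H M) (m : M) : Submodule k M :=
  LinearMap.range ((LinearMap.applyₗ m : Module.End k M →ₗ[k] M) ∘ₗ V.act.toLinearMap)

lemma mem_orbit (V : YetterDrinfeld k H M) {m n : M} :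
    n ∈ V.orbit m ↔ ∃ h : H, V.act h m = n := Iff.rfl

variable [BijectiveAntipode k H]

/-- If `δ(m) = m ⊗ c` then `δ(h · m) = ∑ h₂ · m ⊗ h₃ c S⁻¹(h₁)`. -/
lemma coact_act (V : YetterDrinfeld k H M) {m : M} {c : H} (hm : V.coact m = m ⊗ₜ c) (h : H) :
    V.coact (V.act h m) = ∑ i ∈ (ℛ k h).index, ∑ j ∈ (ℛ k ((ℛ k h).right i)).index,
      V.act ((ℛ k ((ℛ k h).right i)).left j) m ⊗ₜ[k]
        ((ℛ k ((ℛ k h).right i)).right j * c * antipodeInv k H ((ℛ k h).left i)) := by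
  let R : H → (M ⊗[k] H →ₗ[k] M ⊗[k] H) := fun x => TensorProduct.map .id (LinearMap.mulRight k x)
  have hR : ∀ x y, R (x + y) = R x + R y := fun x y => by
    simp only [R]
    rw [← TensorProduct.map_add_right]; congr 1; ext; simp [mul_add]
  have hRs : ∀ (a : k) x, R (a • x) = a • R x := fun a x => by
    simp only [R]
    rw [← TensorProduct.map_smul_right]; congr 1; ext; simp
  have e1 : ∀ i, ∑ j ∈ (ℛ k ((ℛ k h).right i)).index,
      V.act ((ℛ k ((ℛ k h).right i)).left j) m ⊗ₜ[k]
        ((ℛ k ((ℛ k h).right i)).right j * c * antipodeInv k H ((ℛ k h).left i)) =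
      ∑ j ∈ (ℛ k ((ℛ k h).right i)).index,
        R ((ℛ k ((ℛ k h).right i)).left j * antipodeInv k H ((ℛ k h).left i))
          (V.coact (V.act ((ℛ k ((ℛ k h).right i)).right j) m)) := by
    intro i
    have h1 := congrArg (R (antipodeInv k H ((ℛ k h).left i))) (V.compat ((ℛ k h).right i) m)
    simp only [hm, map_sum, TensorProduct.map_tmul] at h1
    refine h1.trans (Finset.sum_congr rfl fun j _ => ?_)
    simp only [R, map_map_apply, LinearMap.comp_id]
    rw [← LinearMap.mulRight_mul]
  simp only [e1]
  rw [← sum_coassoc (fun p q r => R (q * antipodeInv k H p) (V.coact (V.act r m)))]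
  rotate_left
  · exact fun _ _ => ⟨fun _ _ => by simp [mul_add, hR], fun _ _ => by simp [hRs]⟩
  · exact fun _ _ => ⟨fun _ _ => by simp [add_mul, hR], fun _ _ => by simp [hRs]⟩
  · exact fun _ _ => ⟨fun _ _ => by simp, fun _ _ => by simp⟩
  let R' : H →ₗ[k] (M ⊗[k] H →ₗ[k] M ⊗[k] H) := ⟨⟨R, hR⟩, hRs⟩
  have e2 : ∀ i, ∑ j ∈ (ℛ k ((ℛ k h).left i)).index,
      R ((ℛ k ((ℛ k h).left i)).right j * antipodeInv k H ((ℛ k ((ℛ k h).left i)).left j))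
        (V.coact (V.act ((ℛ k h).right i) m)) =
      V.coact (V.act (counit (R := k) ((ℛ k h).left i) • (ℛ k h).right i) m) := by
    intro i
    change ∑ j ∈ _, R' _ _ = _
    rw [← LinearMap.sum_apply, ← map_sum, sum_mul_antipodeInv, Algebra.algebraMap_eq_smul_one]
    have : R' 1 = .id := by
      ext; simp [R', R]
    simp [this]
  simp only [e2]
  rw [← map_sum, ← LinearMap.sum_apply, ← map_sum, sum_counit_smul]

/-- If `k m` is a right subcomodule, spanned by `m` with `δ(m) = m ⊗ c`, then `H · m` is a
Yetter-Drinfel'd submodule. -/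
def orbitYD (V : YetterDrinfeld k H M) (m : M) (c : H) (hm : V.coact m = m ⊗ₜ c) :
    YetterDrinfeld k H (V.orbit m) :=
  V.restrict (V.orbit m)
    (by
      rintro h _ ⟨h', rfl⟩
      exact ⟨h * h', by simp⟩)
    (by
      rintro _ ⟨h, rfl⟩
      change V.coact (V.act h m) ∈ _
      rw [V.coact_act hm]
      refine Submodule.sum_mem _ fun i _ => Submodule.sum_mem _ fun j _ => ?_
      exact ⟨(⟨V.act _ m, ⟨_, rfl⟩⟩ : V.orbit m) ⊗ₜ _, rfl⟩)

end orbit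

section HBeta

variable (k H) in
lemma coassoc6 : (TensorProduct.map .id (TensorProduct.assoc k H H H).toLinearMap ∘ₗ
      (TensorProduct.assoc k H (H ⊗[k] H) H).toLinearMap) ∘ₗ
      TensorProduct.map (TensorProduct.map .id comul ∘ₗ comul) .id ∘ₗ comul =
    TensorProduct.map .id (TensorProduct.map .id (comul (R := k)) ∘ₗ comul) ∘ₗ
      comul (R := k) (A := H) := by
  simp only [coassoc_simps]

variable (k H) in
lemma coassoc7 : TensorProduct.map .id
      (TensorProduct.map comul (TensorProduct.map .id comul) ∘ₗ TensorProduct.map .id comul ∘ₗ comul)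
      ∘ₗ comul =
    (TensorProduct.map .id (TensorProduct.assoc k H H (H ⊗[k] (H ⊗[k] H))).symm.toLinearMap ∘ₗ
      (TensorProduct.assoc k H H (H ⊗[k] (H ⊗[k] (H ⊗[k] H)))).toLinearMap) ∘ₗ
    TensorProduct.map comul
      (TensorProduct.map .id (TensorProduct.map .id (comul (R := k)) ∘ₗ comul) ∘ₗ comul) ∘ₗ
      comul (R := k) (A := H) := by
  simp only [coassoc_simps]

variable [BijectiveAntipode k H]

variable (k H) in
/-- `p` acts on `H` as right multiplication by `S⁻¹(p)`. -/
def rightInv : H →ₐ[k] Module.End k H :=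
  AlgHom.ofLinearMap
    { toFun := fun p => LinearMap.mulRight k (antipodeInv k H p)
      map_add' := fun p q => by ext; simp [mul_add]
      map_smul' := fun c p => by ext; simp }
    (by ext; simp) (fun p q => by ext; simp [antipodeInv_mul, mul_assoc])

lemma rightInv_apply (p a : H) : rightInv k H p a = a * antipodeInv k H p := rfl

/-- `q ⊗ r` acts on `H` as `⟨β, q⟩` times left multiplication by `r`. -/
def leftBeta (β : H →ₐ[k] k) : H ⊗[k] H →ₐ[k] Module.End k H :=
  Algebra.TensorProduct.lift ((Algebra.ofId k (Module.End k H)).comp β) (Algebra.lmul k H)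
    (fun q _ => Algebra.commutes (β q) _)

lemma leftBeta_tmul (β : H →ₐ[k] k) (q r a : H) : leftBeta β (q ⊗ₜ r) a = β q • (r * a) := by
  refine (LinearMap.congr_fun (Algebra.TensorProduct.lift_tmul _ _ _ q r) a).trans ?_
  simp [Algebra.ofId_apply, Algebra.algebraMap_eq_smul_one]

lemma commute_rightInv_leftBeta (β : H →ₐ[k] k) (p : H) (w : H ⊗[k] H) :
    Commute (rightInv k H p) (leftBeta β w) := by
  induction w with
  | zero => rw [map_zero]; exact Commute.zero_right _
  | add w w' hw hw' => rw [map_add]; exact hw.add_right hw'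
  | tmul q r =>
    ext b
    simp [leftBeta_tmul, rightInv_apply, mul_assoc]

/-- The action `h ·_β a = ∑ ⟨β, h₂⟩ h₃ a S⁻¹(h₁)` of `H` on itself. -/
def betaAct (β : H →ₐ[k] k) : H →ₐ[k] Module.End k H :=
  (Algebra.TensorProduct.lift (rightInv k H) (leftBeta β)
    (commute_rightInv_leftBeta β)).comp (comul₃ k H)

/-- `p ⊗ (q ⊗ r) ↦ ⟨β, q⟩ r a S⁻¹(p)` -/
lemma lift_beta_tmul (β : H →ₐ[k] k) (p q r a : H) :
    Algebra.TensorProduct.lift (rightInv k H) (leftBeta β) (commute_rightInv_leftBeta β)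
      (p ⊗ₜ (q ⊗ₜ r)) a = β q • (r * a * antipodeInv k H p) := by
  rw [Algebra.TensorProduct.lift_tmul, Module.End.mul_apply, leftBeta_tmul, rightInv_apply,
    smul_mul_assoc]

lemma betaAct_apply (β : H →ₐ[k] k) (h a : H) :
    betaAct β h a = ∑ i ∈ (ℛ k h).index, ∑ j ∈ (ℛ k ((ℛ k h).right i)).index,
      β ((ℛ k ((ℛ k h).right i)).left j) •
        ((ℛ k ((ℛ k h).right i)).right j * a * antipodeInv k H ((ℛ k h).left i)) := by
  rw [betaAct, AlgHom.comp_apply, comul₃_eq]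
  simp only [map_sum, LinearMap.sum_apply, lift_beta_tmul]

lemma HBeta_compat (β : H →ₐ[k] k) (h a : H) :
    ∑ i ∈ (ℛ k h).index,
      TensorProduct.map (betaAct β ((ℛ k h).left i)) (LinearMap.mulLeft k ((ℛ k h).right i))
        (comul (R := k) a) =
    ∑ i ∈ (ℛ k h).index,
      TensorProduct.map .id (LinearMap.mulRight k ((ℛ k h).left i))
        (comul (R := k) (betaAct β ((ℛ k h).right i) a)) := by
  let t : H ⊗[k] H := comul a
  let B : H →ₐ[k] Module.End k H := betaAct β
  let R : H →ₗ[k] H ⊗[k] H := (TensorProduct.mk k H H).flip 1 ∘ₗ antipodeInv k H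
  let P : H ⊗[k] (H ⊗[k] (H ⊗[k] H)) →ₗ[k] H ⊗[k] H :=
    lift₃ (LinearMap.mk₂ k (fun p q => β q • ((LinearMap.mul k (H ⊗[k] H)).flip (t * R p)))
      (fun p p' q => by simp only [map_add, mul_add, smul_add])
      (fun c p q => by rw [map_smul, mul_smul_comm, map_smul, smul_comm])
      (fun p q q' => by rw [map_add, add_smul])
      (fun c p q => by rw [map_smul, smul_eq_mul, mul_smul]))
  have hP : ∀ p q w, P (p ⊗ₜ (q ⊗ₜ w)) = β q • (w * (t * antipodeInv k H p ⊗ₜ 1)) :=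
    fun p q w => rfl
  let C : H ⊗[k] H →ₗ[k] H ⊗[k] H := TensorProduct.map (antipodeInv k H) (antipodeInv k H) ∘ₗ
    (TensorProduct.comm k H H).toLinearMap
  let Q₀ : (H ⊗[k] H) ⊗[k] (H ⊗[k] (H ⊗[k] H)) →ₗ[k] H ⊗[k] H :=
    lift₃ (LinearMap.mk₂ k (fun p q => β q • ((LinearMap.mul k (H ⊗[k] H)).flip (t * C p)))
      (fun p p' q => by simp only [map_add, mul_add, smul_add])
      (fun c p q => by rw [map_smul, mul_smul_comm, map_smul, smul_comm])
      (fun p q q' => by rw [map_add, add_smul])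
      (fun c p q => by rw [map_smul, smul_eq_mul, mul_smul]))
  have hQ₀ : ∀ p₁ p₂ q w, Q₀ ((p₁ ⊗ₜ p₂) ⊗ₜ (q ⊗ₜ w)) =
      β q • (w * (t * antipodeInv k H p₂ ⊗ₜ antipodeInv k H p₁)) := fun _ _ _ _ => rfl
  let Q : H ⊗[k] ((H ⊗[k] H) ⊗[k] (H ⊗[k] (H ⊗[k] H))) →ₗ[k] H ⊗[k] H :=
    TensorProduct.lift (LinearMap.mk₂ k (fun c z => Q₀ z * (1 ⊗ₜ c))
      (fun c c' z => by simp [TensorProduct.tmul_add, mul_add]) (fun s c z => by simp)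
      (fun c z z' => by simp [add_mul]) (fun s c z => by simp))
  have hQ : ∀ c z, Q (c ⊗ₜ z) = Q₀ z * (1 ⊗ₜ c) := fun _ _ => rfl
  have hL : ∀ u : H ⊗[k] H, TensorProduct.lift
      (LinearMap.mk₂ k (fun p s => TensorProduct.map (B p) (LinearMap.mulLeft k s) t)
        (fun p p' s => by simp [TensorProduct.map_add_left])
        (fun c p s => by simp [TensorProduct.map_smul_left])
        (fun p s s' => by
          rw [← LinearMap.add_apply, ← TensorProduct.map_add_right]
          congr 2; ext; simp [add_mul])
        (fun c p s => by
          rw [← LinearMap.smul_apply, ← TensorProduct.map_smul_right]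
          congr 2; ext; simp)) u =
      P ((TensorProduct.map .id (TensorProduct.assoc k H H H).toLinearMap ∘ₗ
        (TensorProduct.assoc k H (H ⊗[k] H) H).toLinearMap)
        (TensorProduct.map (comul₃ k H).toLinearMap .id u)) := by
    intro u
    induction u with
    | zero => simp
    | add u u' hu hu' => simp only [map_add, hu, hu']
    | tmul p s =>
      change TensorProduct.map (Algebra.TensorProduct.lift (rightInv k H) (leftBeta β)
        (commute_rightInv_leftBeta β) (comul₃ k H p)) (LinearMap.mulLeft k s) t =
        P ((TensorProduct.map .id (TensorProduct.assoc k H H H).toLinearMap ∘ₗ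
        (TensorProduct.assoc k H (H ⊗[k] H) H).toLinearMap) ((comul₃ k H p) ⊗ₜ s))
      generalize comul₃ k H p = v
      induction v with
      | zero => simp
      | add v v' hv hv' => simp only [map_add, TensorProduct.map_add_left, LinearMap.add_apply,
          hv, hv', TensorProduct.add_tmul]
      | tmul p w =>
        induction w with
        | zero => simp
        | add v v' hv hv' => simp only [map_add, TensorProduct.map_add_left, LinearMap.add_apply,
            hv, hv', TensorProduct.add_tmul, TensorProduct.tmul_add]
        | tmul q r =>
          change _ = P (p ⊗ₜ (q ⊗ₜ (r ⊗ₜ s)))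
          rw [hP]
          generalize t = t
          induction t with
          | zero => simp
          | add v v' hv hv' => simp only [map_add, hv, hv', add_mul, mul_add, smul_add]
          | tmul b c =>
            rw [TensorProduct.map_tmul, lift_beta_tmul]
            simp [TensorProduct.smul_tmul', mul_assoc]
  have hR : ∀ u : H ⊗[k] H, TensorProduct.lift
      (LinearMap.mk₂ k (fun c p => TensorProduct.map .id (LinearMap.mulRight k c)
          (comul (R := k) (B p a)))
        (fun p s s' => by
          rw [← LinearMap.add_apply, ← TensorProduct.map_add_right]
          congr 2; ext; simp [mul_add])
        (fun c p s => by
          rw [← LinearMap.smul_apply, ← TensorProduct.map_smul_right]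
          congr 2; ext; simp)
        (fun p p' s => by simp)
        (fun c p s => by simp)) u =
      Q (TensorProduct.map .id (TensorProduct.map comul (TensorProduct.map .id comul) ∘ₗ
        (comul₃ k H).toLinearMap) u) := by
    intro u
    induction u with
    | zero => simp
    | add u u' hu hu' => simp only [map_add, hu, hu']
    | tmul c p =>
      change TensorProduct.map .id (LinearMap.mulRight k c) (comul (Algebra.TensorProduct.lift
        (rightInv k H) (leftBeta β) (commute_rightInv_leftBeta β) (comul₃ k H p) a)) =
        Q (c ⊗ₜ (TensorProduct.map comul (TensorProduct.map .id comul) (comul₃ k H p)))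
      generalize comul₃ k H p = v
      induction v with
      | zero => simp
      | add v v' hv hv' => simp only [map_add, LinearMap.add_apply, hv, hv', TensorProduct.tmul_add]
      | tmul p w =>
        induction w with
        | zero => simp
        | add v v' hv hv' => simp only [map_add, LinearMap.add_apply, hv, hv',
            TensorProduct.tmul_add]
        | tmul q r =>
          rw [lift_beta_tmul, map_smul, map_smul, Bialgebra.comul_mul, Bialgebra.comul_mul,
            comul_antipodeInv]
          simp only [TensorProduct.map_tmul, LinearMap.id_apply]
          rw [hQ]
          have hm : ∀ z : H ⊗[k] H,
              TensorProduct.map .id (LinearMap.mulRight k c) z = z * 1 ⊗ₜ c := by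
            intro z
            induction z with
            | zero => simp
            | add v v' hv hv' => simp only [map_add, hv, hv', add_mul]
            | tmul b c => simp
          rw [hm, ← smul_mul_assoc]
          congr 1
          change _ = β q • (comul r * (t * C (comul p)))
          rw [mul_assoc]
          rfl
  have h6 := LinearMap.congr_fun (coassoc6 k H) h
  have h7 := LinearMap.congr_fun (coassoc7 k H) h
  have eL := hL (comul h)
  have eR := hR (comul h)
  have c3 : (comul₃ k H).toLinearMap = TensorProduct.map .id comul ∘ₗ comul := rfl
  rw [c3] at eL eR
  have key : ∀ (l : H) (v : H ⊗[k] (H ⊗[k] (H ⊗[k] H))),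
      Q ((TensorProduct.map .id (TensorProduct.assoc k H H (H ⊗[k] (H ⊗[k] H))).symm.toLinearMap ∘ₗ
        (TensorProduct.assoc k H H (H ⊗[k] (H ⊗[k] (H ⊗[k] H)))).toLinearMap) (comul l ⊗ₜ v)) =
      counit (R := k) l • P v := by
    intro l v
    induction v with
    | zero => simp
    | add v v' hv hv' => simp only [map_add, TensorProduct.tmul_add, hv, hv', smul_add]
    | tmul p w =>
      induction w with
      | zero => simp
      | add v v' hv hv' => simp only [map_add, TensorProduct.tmul_add, hv, hv', smul_add]
      | tmul q w =>
        have hA := sum_antipodeInv_mul k (ℛ k l)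
        conv_lhs => rw [← (ℛ k l).eq]
        simp only [TensorProduct.sum_tmul, map_sum]
        have : ∀ c p₁ : H, Q ((TensorProduct.map .id
            (TensorProduct.assoc k H H (H ⊗[k] (H ⊗[k] H))).symm.toLinearMap ∘ₗ
            (TensorProduct.assoc k H H (H ⊗[k] (H ⊗[k] (H ⊗[k] H)))).toLinearMap)
            ((c ⊗ₜ p₁) ⊗ₜ (p ⊗ₜ (q ⊗ₜ w)))) =
            β q • (w * (t * antipodeInv k H p ⊗ₜ (antipodeInv k H p₁ * c))) := by
          intro c p₁
          change Q₀ ((p₁ ⊗ₜ p) ⊗ₜ (q ⊗ₜ w)) * (1 ⊗ₜ c) = _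
          rw [hQ₀, smul_mul_assoc, mul_assoc, mul_assoc, Algebra.TensorProduct.tmul_mul_tmul,
            mul_one]
        simp only [this]
        rw [← Finset.smul_sum, ← Finset.mul_sum, ← Finset.mul_sum, ← TensorProduct.tmul_sum, hA,
          hP, Algebra.algebraMap_eq_smul_one, TensorProduct.tmul_smul, mul_smul_comm,
          mul_smul_comm, smul_comm]
  have e1 : ∀ F : H →ₗ[k] H →ₗ[k] H ⊗[k] H, TensorProduct.lift F (comul (R := k) h) =
      ∑ i ∈ (ℛ k h).index, F ((ℛ k h).left i) ((ℛ k h).right i) := by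
    intro F
    conv_lhs => rw [← (ℛ k h).eq]
    simp only [map_sum, TensorProduct.lift.tmul]
  rw [e1] at eL eR
  refine eL.trans (Eq.trans ?_ eR.symm)
  refine (congrArg P h6).trans (Eq.trans ?_ (congrArg Q h7).symm)
  simp only [LinearMap.comp_apply]
  set Δ₄ : H →ₗ[k] H ⊗[k] (H ⊗[k] (H ⊗[k] H)) :=
    TensorProduct.map .id (TensorProduct.map .id (comul (R := k)) ∘ₗ comul) ∘ₗ
      comul (R := k) (A := H) with hΔ
  change P (Δ₄ h) = _
  conv_rhs => rw [← (ℛ k h).eq]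
  simp only [map_sum, TensorProduct.map_tmul]
  simp only [LinearMap.comp_apply] at key
  simp only [key]
  rw [← LinearMap.comp_apply]
  simp only [← LinearMap.comp_apply P Δ₄, ← map_smul]
  rw [← map_sum, sum_counit_smul]

/-- The Yetter-Drinfel'd module `H_β = (H, ·_β, Δ)`. -/
def HBeta (β : H →ₐ[k] k) : YetterDrinfeld k H H where
  act := betaAct β
  coact := comul
  coassoc := Coalgebra.coassoc
  counit_coact := by
    ext h
    simp
  compat := HBeta_compat β

end HBeta

end YetterDrinfeld

end YD

end Double

section QBinomial

variable {k A : Type*} [Field k] [Ring A] [Algebra k A]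

/-- The `q`-binomial coefficient `(i + j choose i)_q`. -/
def qBinom (q : k) : ℕ → ℕ → k
  | 0, _ => 1
  | _ + 1, 0 => 1
  | i + 1, j + 1 => qBinom q i (j + 1) + q ^ (i + 1) * qBinom q (i + 1) j

/-- The `q`-number `1 + q + ⋯ + q ^ (n - 1)`. -/
def qNum (q : k) (n : ℕ) : k := ∑ t ∈ Finset.range n, q ^ t

/-- The `q`-factorial. -/
def qFact (q : k) (n : ℕ) : k := ∏ t ∈ Finset.range n, qNum q (t + 1)

lemma qNum_add (q : k) (m n : ℕ) : qNum q (m + n) = qNum q m + q ^ m * qNum q n := by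
  simp [qNum, Finset.sum_range_add, Finset.mul_sum, pow_add]

lemma qBinom_mul (q : k) : ∀ i j : ℕ, qBinom q i j * qFact q i * qFact q j = qFact q (i + j)
  | 0, j => by simp [qBinom, qFact]
  | i + 1, 0 => by simp [qBinom, qFact]
  | i + 1, j + 1 => by
    have h1 := qBinom_mul q i (j + 1)
    have h2 := qBinom_mul q (i + 1) j
    have e1 : qFact q (i + 1 + (j + 1)) = qFact q (i + (j + 1)) * qNum q (i + 1 + (j + 1)) := by
      rw [show i + 1 + (j + 1) = (i + (j + 1)) + 1 by ring, qFact, Finset.prod_range_succ]; rfl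
    have e2 : i + 1 + j = i + (j + 1) := by ring
    have e3 : qFact q (i + 1) = qFact q i * qNum q (i + 1) := Finset.prod_range_succ _ _
    have e4 : qFact q (j + 1) = qFact q j * qNum q (j + 1) := Finset.prod_range_succ _ _
    rw [e2] at h2
    rw [e1, qNum_add, qBinom]
    calc _ = qNum q (i + 1) * (qBinom q i (j + 1) * qFact q i * qFact q (j + 1))
          + q ^ (i + 1) * qNum q (j + 1) * (qBinom q (i + 1) j * qFact q (i + 1) * qFact q j) := by
            rw [e3, e4]; ring
      _ = _ := by rw [h1, h2]; ring

lemma qBinom_eq_zero (q : k) (i j : ℕ) (hi : 0 < i) (hj : 0 < j) (h : orderOf q = i + j) :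
    qBinom q i j = 0 := by
  have hq : ∀ n, qNum q n * (q - 1) = q ^ n - 1 := fun n => geom_sum_mul q n
  have hne : ∀ n, 0 < n → n < i + j → qNum q n ≠ 0 := by
    intro n h0 hn h1
    have := hq n
    rw [h1, zero_mul] at this
    exact pow_ne_one_of_lt_orderOf h0.ne' (h ▸ hn) (sub_eq_zero.mp this.symm)
  have hF : ∀ n, n < i + j → qFact q n ≠ 0 := fun n hn =>
    Finset.prod_ne_zero_iff.mpr fun t ht => hne _ (Nat.succ_pos t) (by
      have := Finset.mem_range.mp ht; omega)
  have hq1 : q ≠ 1 := by rintro rfl; rw [orderOf_one] at h; omega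
  have h0 : qNum q (i + j) = 0 := by
    have := hq (i + j)
    rw [← h, pow_orderOf_eq_one, sub_self] at this
    rw [← h]
    exact (mul_eq_zero.mp this).resolve_right (sub_ne_zero.mpr hq1)
  have h1 : qFact q (i + j) = 0 :=
    Finset.prod_eq_zero (Finset.mem_range.mpr (show i + j - 1 < i + j by omega))
      (by rw [Nat.sub_add_cancel (by omega)]; exact h0)
  have h2 := qBinom_mul q i j
  rw [h1] at h2
  exact (mul_eq_zero.mp ((mul_eq_zero.mp h2).resolve_right (hF j (by omega)))).resolve_right
    (hF i (by omega))

lemma comm_pow (q : k) {x y : A} (hxy : y * x = q • (x * y)) (i : ℕ) :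
    y * x ^ i = q ^ i • (x ^ i * y) := by
  induction i with
  | zero => simp
  | succ i ih =>
    rw [pow_succ, ← mul_assoc, ih, smul_mul_assoc, mul_assoc, hxy, mul_smul_comm, smul_smul,
      ← mul_assoc, pow_succ]

lemma add_pow_qBinom (q : k) {x y : A} (hxy : y * x = q • (x * y)) (n : ℕ) :
    (x + y) ^ n = ∑ p ∈ Finset.HasAntidiagonal.antidiagonal n, qBinom q p.1 p.2 • (x ^ p.1 * y ^ p.2) := by
  induction n with
  | zero => simp [qBinom]
  | succ n ih =>
    have hL : (x + y) ^ (n + 1) = (∑ p ∈ Finset.HasAntidiagonal.antidiagonal n,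
        qBinom q p.1 p.2 • (x ^ (p.1 + 1) * y ^ p.2)) + ∑ p ∈ Finset.HasAntidiagonal.antidiagonal n,
        (q ^ p.1 * qBinom q p.1 p.2) • (x ^ p.1 * y ^ (p.2 + 1)) := by
      rw [pow_succ', ih, add_mul, Finset.mul_sum, Finset.mul_sum]
      congr 1
      · refine Finset.sum_congr rfl fun p _ => ?_
        rw [mul_smul_comm, ← mul_assoc, ← pow_succ']
      · refine Finset.sum_congr rfl fun p _ => ?_
        rw [mul_smul_comm, ← mul_assoc, comm_pow q hxy, smul_mul_assoc, smul_smul, mul_assoc,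
          ← pow_succ', mul_comm]
    rw [hL]
    cases n with
    | zero => simp [qBinom, Finset.Nat.antidiagonal_succ]; abel
    | succ n =>
      have hz : ∀ m, qBinom q m 0 = 1 := by intro m; cases m <;> simp [qBinom]
      have hz' : ∀ m, qBinom q 0 m = 1 := by intro m; cases m <;> simp [qBinom]
      have hR : ∀ F : ℕ × ℕ → A, ∑ p ∈ Finset.HasAntidiagonal.antidiagonal (n + 1 + 1), F p =
          F (0, n + 2) + (∑ p ∈ Finset.HasAntidiagonal.antidiagonal n, F (p.1 + 1, p.2 + 1)) +
            F (n + 2, 0) := by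
        intro F
        rw [Finset.Nat.sum_antidiagonal_succ, Finset.Nat.sum_antidiagonal_succ']
        abel
      rw [hR, Finset.Nat.sum_antidiagonal_succ', Finset.Nat.sum_antidiagonal_succ]
      simp only [qBinom, hz, hz', add_smul, Finset.sum_add_distrib, pow_zero, one_smul, mul_one,
        one_mul]
      abel

/-- The `q`-binomial theorem at a root of unity. -/
lemma add_pow_orderOf (q : k) (hq : 0 < orderOf q) {x y : A} (hxy : y * x = q • (x * y)) :
    (x + y) ^ orderOf q = x ^ orderOf q + y ^ orderOf q := by
  have hz : ∀ m, qBinom q m 0 = 1 := by intro m; cases m <;> simp [qBinom]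
  have hz' : ∀ m, qBinom q 0 m = 1 := by intro m; cases m <;> simp [qBinom]
  rw [add_pow_qBinom q hxy]
  have hne : ((0 : ℕ), orderOf q) ≠ (orderOf q, 0) := by
    intro h; have := (Prod.ext_iff.mp h).1; simp at this; omega
  rw [← Finset.sum_subset (s₁ := {(orderOf q, 0), (0, orderOf q)})]
  · rw [Finset.sum_pair hne.symm]; simp [hz, hz']
  · intro p hp
    simp at hp
    rcases hp with rfl | rfl <;> simp
  · rintro ⟨i, j⟩ hp hn
    simp at hp hn
    have hi : 0 < i := by
      rcases Nat.eq_zero_or_pos i with rfl | h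
      · exact absurd (by omega) (hn.2 rfl)
      · exact h
    have hj : 0 < j := by
      rcases Nat.eq_zero_or_pos j with rfl | h
      · exact absurd rfl (hn.1 (by omega))
      · exact h
    rw [qBinom_eq_zero q i j hi hj hp.symm, zero_smul]

end QBinomial

section Presentation

variable {k : Type u} [Field k] {G : Type v} [CommGroup G]

/-- The generators of `H_D`: the elements of `G` and one further generator `x`. -/
inductive Gen (G : Type v) : Type v
  | grp : G → Gen G
  | x : Gen G

/-- The defining relations of `H_D` for the data `D = (G, χ, a)`: those of the group `G`, together
with `x ^ ℓ = 0` and `x g = χ(g) g x`, where `ℓ` is the order of `χ(a)`. -/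
inductive Rel (χ : G →* kˣ) (a : G) : FreeAlgebra k (Gen G) → FreeAlgebra k (Gen G) → Prop
  | one : Rel χ a (FreeAlgebra.ι k (.grp 1)) 1
  | mul (g h : G) : Rel χ a (FreeAlgebra.ι k (.grp g) * FreeAlgebra.ι k (.grp h))
      (FreeAlgebra.ι k (.grp (g * h)))
  | x_pow : Rel χ a (FreeAlgebra.ι k .x ^ orderOf (χ a)) 0
  | x_mul (g : G) : Rel χ a (FreeAlgebra.ι k .x * FreeAlgebra.ι k (.grp g))
      ((χ g : k) • (FreeAlgebra.ι k (.grp g) * FreeAlgebra.ι k .x))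

/-- The algebra `H_D` attached to the data `D = (G, χ, a)`. -/
def HD (χ : G →* kˣ) (a : G) : Type (max u v) := RingQuot (Rel χ a)

variable (χ : G →* kˣ) (a : G)

instance : Ring (HD χ a) := inferInstanceAs (Ring (RingQuot (Rel χ a)))

instance : Algebra k (HD χ a) := inferInstanceAs (Algebra k (RingQuot (Rel χ a)))

namespace HD

/-- The projection of the free algebra onto `H_D`. -/
def proj : FreeAlgebra k (Gen G) →ₐ[k] HD χ a := RingQuot.mkAlgHom k (Rel χ a)

/-- The image in `H_D` of an element of `G`. -/
def grp (g : G) : HD χ a := proj χ a (FreeAlgebra.ι k (.grp g))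

/-- The generator `x` of `H_D`. -/
def x : HD χ a := proj χ a (FreeAlgebra.ι k .x)

lemma proj_rel {r s : FreeAlgebra k (Gen G)} (h : Rel χ a r s) : proj χ a r = proj χ a s :=
  RingQuot.mkAlgHom_rel k h

lemma grp_one : grp χ a 1 = 1 := by
  simpa [grp] using proj_rel χ a .one

lemma grp_mul (g h : G) : grp χ a (g * h) = grp χ a g * grp χ a h := by
  simpa [grp] using (proj_rel χ a (.mul g h)).symm

lemma x_pow : x χ a ^ orderOf (χ a) = 0 := by
  simpa [x] using proj_rel χ a .x_pow

lemma x_mul_grp (g : G) : x χ a * grp χ a g = (χ g : k) • (grp χ a g * x χ a) := by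
  simpa [x, grp] using proj_rel χ a (.x_mul g)

lemma grp_mul_inv (g : G) : grp χ a g * grp χ a g⁻¹ = 1 := by
  rw [← grp_mul, mul_inv_cancel, grp_one]

lemma grp_inv_mul (g : G) : grp χ a g⁻¹ * grp χ a g = 1 := by
  rw [← grp_mul, inv_mul_cancel, grp_one]

variable {χ a}

/-- The universal property of the presentation of `H_D`. -/
def lift {B : Type*} [Ring B] [Algebra k B] (φ : G →* B) (y : B)
    (h1 : y ^ orderOf (χ a) = 0) (h2 : ∀ g, y * φ g = (χ g : k) • (φ g * y)) : HD χ a →ₐ[k] B :=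
  RingQuot.liftAlgHom k ⟨FreeAlgebra.lift k (fun s => match s with
    | .grp g => φ g
    | .x => y), by
      intro r s h
      cases h <;> simp [h1, h2]⟩

section
variable {B : Type*} [Ring B] [Algebra k B] (φ : G →* B) (y : B)
    (h1 : y ^ orderOf (χ a) = 0) (h2 : ∀ g, y * φ g = (χ g : k) • (φ g * y))

@[simp] lemma lift_grp (g : G) : lift φ y h1 h2 (grp χ a g) = φ g :=
  (RingQuot.liftAlgHom_mkAlgHom_apply k _ _ _).trans (by simp)

@[simp] lemma lift_x : lift φ y h1 h2 (x χ a) = y :=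
  (RingQuot.liftAlgHom_mkAlgHom_apply k _ _ _).trans (by simp)
end

lemma proj_surjective : Function.Surjective (proj χ a) := RingQuot.mkAlgHom_surjective k _

@[elab_as_elim]
lemma induction {P : HD χ a → Prop} (hk : ∀ c : k, P (algebraMap k _ c))
    (hg : ∀ g, P (grp χ a g)) (hx : P (x χ a))
    (hm : ∀ u v, P u → P v → P (u * v)) (ha : ∀ u v, P u → P v → P (u + v)) (h : HD χ a) : P h := by
  obtain ⟨t, rfl⟩ := proj_surjective h
  induction t using FreeAlgebra.induction with
  | grade0 c => simpa using hk c
  | grade1 s => cases s with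
    | grp g => exact hg g
    | x => exact hx
  | mul u v hu hv => rw [map_mul]; exact hm _ _ hu hv
  | add u v hu hv => rw [map_add]; exact ha _ _ hu hv

lemma algHom_ext {B : Type*} [Semiring B] [Algebra k B] {f f' : HD χ a →ₐ[k] B}
    (hg : ∀ g, f (grp χ a g) = f' (grp χ a g)) (hx : f (x χ a) = f' (x χ a)) : f = f' := by
  ext h
  induction h using induction with
  | hk c => simp
  | hg g => exact hg g
  | hx => exact hx
  | hm u v hu hv => simp [hu, hv]
  | ha u v hu hv => simp [hu, hv]

variable (χ a) in
def comulGrp : G →* HD χ a ⊗[k] HD χ a where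
  toFun g := grp χ a g ⊗ₜ grp χ a g
  map_one' := by simp [grp_one, Algebra.TensorProduct.one_def]
  map_mul' g h := by simp [grp_mul]

@[simp] lemma comulGrp_apply (g : G) : comulGrp χ a g = grp χ a g ⊗ₜ grp χ a g := rfl

variable (χ a) in
def antipodeGrp : G →* (HD χ a)ᵐᵒᵖ where
  toFun g := .op (grp χ a g⁻¹)
  map_one' := by simp [grp_one]
  map_mul' g h := by simp [grp_mul, mul_inv_rev, ← MulOpposite.op_mul]

@[simp] lemma antipodeGrp_apply (g : G) : antipodeGrp χ a g = .op (grp χ a g⁻¹) := rfl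

lemma mul_pow_of_qcomm {B : Type*} [Ring B] [Algebra k B] (q : k) {y z : B}
    (h : y * z = q • (z * y)) (n : ℕ) (hy : y ^ n = 0) : (z * y) ^ n = 0 := by
  have : ∀ n, ∃ c : k, (z * y) ^ n = c • (z ^ n * y ^ n) := by
    intro n
    induction n with
    | zero => exact ⟨1, by simp⟩
    | succ n ih =>
      obtain ⟨c, hc⟩ := ih
      have hn : ∀ m, y ^ m * z = q ^ m • (z * y ^ m) := by
        intro m
        induction m with
        | zero => simp
        | succ m ihm =>
          rw [pow_succ y, mul_assoc, h, mul_smul_comm, ← mul_assoc, ihm, smul_mul_assoc, smul_smul,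
            mul_assoc, ← pow_succ, ← pow_succ']
      refine ⟨c * q ^ n, ?_⟩
      rw [pow_succ, hc, smul_mul_assoc, mul_assoc, ← mul_assoc (y ^ n), hn, smul_mul_assoc,
        mul_smul_comm, smul_smul, ← mul_assoc, ← mul_assoc, ← pow_succ, mul_assoc, ← pow_succ]
  obtain ⟨c, hc⟩ := this n
  rw [hc, hy, mul_zero, smul_zero]

lemma x_mul_grp_inv (g : G) :
    grp χ a g⁻¹ * x χ a = (χ g : k) • (x χ a * grp χ a g⁻¹) := by
  rw [x_mul_grp, smul_smul, ← Units.val_mul, ← map_mul]; simp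

lemma grp_mul_x_pow (g : G) : (grp χ a g * x χ a) ^ orderOf (χ a) = 0 :=
  mul_pow_of_qcomm _ (x_mul_grp χ a g) _ (x_pow χ a)

lemma x_mul_grp_pow (g : G) : (x χ a * grp χ a g) ^ orderOf (χ a) = 0 := by
  rw [x_mul_grp, smul_pow, grp_mul_x_pow, smul_zero]

variable [Finite G]

lemma orderOf_chi_pos : 0 < orderOf (χ a) := by
  have : IsOfFinOrder (χ a) := χ.isOfFinOrder (isOfFinOrder_of_finite a)
  exact this.orderOf_pos

variable (χ a) in
/-- `Δ(g) = g ⊗ g` for `g ∈ G`, and `Δ(x) = x ⊗ a + 1 ⊗ x`. -/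
def comulHom : HD χ a →ₐ[k] HD χ a ⊗[k] HD χ a :=
  lift (comulGrp χ a)
    (x χ a ⊗ₜ grp χ a a + 1 ⊗ₜ x χ a)
    (by
      have hq : orderOf ((χ a : kˣ) : k) = orderOf (χ a) := orderOf_units
      rw [← hq, add_pow_orderOf ((χ a : kˣ) : k) (hq ▸ orderOf_chi_pos)]
      · rw [hq, Algebra.TensorProduct.tmul_pow, Algebra.TensorProduct.tmul_pow, x_pow]
        simp
      · simp [x_mul_grp])
    (fun g => by
      simp [add_mul, mul_add, x_mul_grp, TensorProduct.smul_tmul', ← grp_mul, mul_comm a g])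

variable (χ a) in
/-- `ε(g) = 1` for `g ∈ G`, and `ε(x) = 0`. -/
def counitHom : HD χ a →ₐ[k] k :=
  lift 1 0 (zero_pow orderOf_chi_pos.ne') (fun g => by simp)

instance : Bialgebra k (HD χ a) :=
  Bialgebra.ofAlgHom (comulHom χ a) (counitHom χ a)
    (algHom_ext (fun g => by simp [comulHom]) (by
      simp [comulHom, TensorProduct.add_tmul, TensorProduct.tmul_add, Algebra.TensorProduct.one_def,
        add_assoc]))
    (algHom_ext (fun g => by simp [comulHom, counitHom]) (by simp [comulHom, counitHom]))
    (algHom_ext (fun g => by simp [comulHom, counitHom]) (by simp [comulHom, counitHom]))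

open Coalgebra HopfAlgebra

@[simp] lemma comul_grp (g : G) : comul (R := k) (grp χ a g) = grp χ a g ⊗ₜ grp χ a g :=
  lift_grp _ _ _ _ g

@[simp] lemma comul_x : comul (R := k) (x χ a) = x χ a ⊗ₜ grp χ a a + 1 ⊗ₜ x χ a :=
  lift_x _ _ _ _

@[simp] lemma counit_grp (g : G) : counit (R := k) (grp χ a g) = 1 := lift_grp _ _ _ _ g

@[simp] lemma counit_x : counit (R := k) (x χ a) = 0 := lift_x _ _ _ _

variable (χ a) in
/-- The antipode: `S(g) = g⁻¹`, `S(x) = - x a⁻¹`. -/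
def antipodeHom : HD χ a →ₐ[k] (HD χ a)ᵐᵒᵖ :=
  lift (antipodeGrp χ a) (.op (-(x χ a * grp χ a a⁻¹)))
    (by
      rw [← MulOpposite.op_pow, neg_pow, x_mul_grp_pow, mul_zero, MulOpposite.op_zero])
    (fun g => by
      apply MulOpposite.unop_injective
      simp [← mul_assoc, x_mul_grp_inv]
      simp [mul_assoc, ← grp_mul, mul_comm])

variable (χ a) in
/-- The inverse of the antipode: `g ↦ g⁻¹`, `x ↦ - a⁻¹ x`. -/
def antipodeInvHom : HD χ a →ₐ[k] (HD χ a)ᵐᵒᵖ :=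
  lift (antipodeGrp χ a) (.op (-(grp χ a a⁻¹ * x χ a)))
    (by
      rw [← MulOpposite.op_pow, neg_pow, grp_mul_x_pow, mul_zero, MulOpposite.op_zero])
    (fun g => by
      apply MulOpposite.unop_injective
      simp only [MulOpposite.unop_mul, MulOpposite.unop_smul, antipodeGrp_apply,
        MulOpposite.unop_op, mul_neg, neg_mul, smul_neg]
      rw [← mul_assoc, ← grp_mul, mul_comm, grp_mul, mul_assoc, x_mul_grp_inv, mul_smul_comm,
        mul_assoc])


lemma antipode_aux {H : Type*} [Ring H] [Algebra k H] (S : H →ₗ[k] H)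
    (hS : ∀ u v, S (u * v) = S v * S u) (t : H ⊗[k] H) (c : k)
    (ht : LinearMap.mul' k H (S.rTensor H t) = algebraMap k H c) (w : H ⊗[k] H) :
    LinearMap.mul' k H (S.rTensor H (t * w)) =
      c • LinearMap.mul' k H (S.rTensor H w) := by
  induction w with
  | zero => simp
  | add w₁ w₂ h₁ h₂ => rw [mul_add, map_add, map_add, h₁, h₂, map_add, map_add, smul_add]
  | tmul r s =>
    have key : LinearMap.mul' k H (S.rTensor H (t * r ⊗ₜ s)) =
        S r * LinearMap.mul' k H (S.rTensor H t) * s := by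
      clear ht
      induction t with
      | zero => simp
      | add t₁ t₂ h₁ h₂ => simp only [add_mul, mul_add, map_add, h₁, h₂]
      | tmul p q => simp [hS, mul_assoc]
    rw [key, ht, ← Algebra.commutes, mul_assoc, ← Algebra.smul_def]
    simp

lemma antipode_aux' {H : Type*} [Ring H] [Algebra k H] (S : H →ₗ[k] H)
    (hS : ∀ u v, S (u * v) = S v * S u) (t : H ⊗[k] H) (c : k)
    (ht : LinearMap.mul' k H (S.lTensor H t) = algebraMap k H c) (w : H ⊗[k] H) :
    LinearMap.mul' k H (S.lTensor H (w * t)) =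
      c • LinearMap.mul' k H (S.lTensor H w) := by
  induction w with
  | zero => simp
  | add w₁ w₂ h₁ h₂ => rw [add_mul, map_add, map_add, h₁, h₂, map_add, map_add, smul_add]
  | tmul r s =>
    have key : LinearMap.mul' k H (S.lTensor H (r ⊗ₜ s * t)) =
        r * LinearMap.mul' k H (S.lTensor H t) * S s := by
      clear ht
      induction t with
      | zero => simp
      | add t₁ t₂ h₁ h₂ => simp only [add_mul, mul_add, map_add, h₁, h₂]
      | tmul p q => simp [hS, mul_assoc]
    rw [key, ht, ← Algebra.commutes, mul_assoc, ← Algebra.smul_def]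
    simp

variable (χ a) in
def antipodeLin : HD χ a →ₗ[k] HD χ a :=
  (MulOpposite.opLinearEquiv k).symm.toLinearMap ∘ₗ (antipodeHom χ a).toLinearMap

variable (χ a) in
def antipodeInvLin : HD χ a →ₗ[k] HD χ a :=
  (MulOpposite.opLinearEquiv k).symm.toLinearMap ∘ₗ (antipodeInvHom χ a).toLinearMap

lemma antipodeLin_mul (u v : HD χ a) :
    antipodeLin χ a (u * v) = antipodeLin χ a v * antipodeLin χ a u := by
  simp [antipodeLin]

lemma antipodeInvLin_mul (u v : HD χ a) :
    antipodeInvLin χ a (u * v) = antipodeInvLin χ a v * antipodeInvLin χ a u := by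
  simp [antipodeInvLin]

@[simp] lemma antipodeLin_grp (g : G) : antipodeLin χ a (grp χ a g) = grp χ a g⁻¹ := by
  simp [antipodeLin, antipodeHom]

@[simp] lemma antipodeLin_x : antipodeLin χ a (x χ a) = -(x χ a * grp χ a a⁻¹) := by
  simp [antipodeLin, antipodeHom]

@[simp] lemma antipodeLin_algebraMap (c : k) :
    antipodeLin χ a (algebraMap k _ c) = algebraMap k _ c := by
  simp [antipodeLin]

@[simp] lemma antipodeInvLin_grp (g : G) : antipodeInvLin χ a (grp χ a g) = grp χ a g⁻¹ := by
  simp [antipodeInvLin, antipodeInvHom]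

@[simp] lemma antipodeInvLin_x : antipodeInvLin χ a (x χ a) = -(grp χ a a⁻¹ * x χ a) := by
  simp [antipodeInvLin, antipodeInvHom]

@[simp] lemma antipodeInvLin_algebraMap (c : k) :
    antipodeInvLin χ a (algebraMap k _ c) = algebraMap k _ c := by
  simp [antipodeInvLin]

@[simp] lemma antipodeLin_one : antipodeLin χ a 1 = 1 := by simp [antipodeLin]

@[simp] lemma antipodeInvLin_one : antipodeInvLin χ a 1 = 1 := by simp [antipodeInvLin]

instance : HopfAlgebra k (HD χ a) where
  antipode := antipodeLin χ a
  mul_antipode_rTensor_comul := by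
    ext h
    simp only [LinearMap.comp_apply, Algebra.linearMap_apply]
    induction h using induction with
    | hk c => simp [Algebra.TensorProduct.algebraMap_apply]
    | hg g => simp [grp_inv_mul]
    | hx => simp [mul_assoc, grp_inv_mul]
    | hm u v hu hv =>
      rw [Bialgebra.comul_mul, antipode_aux _ antipodeLin_mul _ _ hu, hv, Bialgebra.counit_mul,
        map_mul, Algebra.smul_def]
    | ha u v hu hv => simp only [map_add, hu, hv]
  mul_antipode_lTensor_comul := by
    ext h
    simp only [LinearMap.comp_apply, Algebra.linearMap_apply]
    induction h using induction with
    | hk c => simp [Algebra.TensorProduct.algebraMap_apply]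
    | hg g => simp [grp_mul_inv]
    | hx => simp
    | hm u v hu hv =>
      rw [Bialgebra.comul_mul, antipode_aux' _ antipodeLin_mul _ _ hv, hu, Bialgebra.counit_mul,
        mul_comm, map_mul, Algebra.smul_def]
    | ha u v hu hv => simp only [map_add, hu, hv]

lemma antipode_bijective : Function.Bijective (antipode k (A := HD χ a)) := by
  have h1 : ∀ h, antipodeInvLin χ a (antipodeLin χ a h) = h := by
    intro h
    induction h using induction with
    | hk c => simp
    | hg g => simp
    | hx => simp [antipodeInvLin_mul, ← mul_assoc, grp_mul_inv]
    | hm u v hu hv => rw [antipodeLin_mul, antipodeInvLin_mul, hu, hv]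
    | ha u v hu hv => simp only [map_add, hu, hv]
  have h2 : ∀ h, antipodeLin χ a (antipodeInvLin χ a h) = h := by
    intro h
    induction h using induction with
    | hk c => simp
    | hg g => simp
    | hx => simp [antipodeLin_mul, mul_assoc, grp_inv_mul]
    | hm u v hu hv => rw [antipodeInvLin_mul, antipodeLin_mul, hu, hv]
    | ha u v hu hv => simp only [map_add, hu, hv]
  exact ⟨Function.LeftInverse.injective h1, Function.RightInverse.surjective h2⟩

/-- `H_D` is spanned by the elements `g xⁱ` with `i < ℓ`. -/
instance : FiniteDimensional k (HD χ a) := by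
  let P : Submodule k (HD χ a) := Submodule.span k
    (Set.range fun p : G × Fin (orderOf (χ a)) => grp χ a p.1 * x χ a ^ (p.2 : ℕ))
  have hP : ∀ g i, grp χ a g * x χ a ^ i ∈ P := by
    intro g i
    by_cases hi : i < orderOf (χ a)
    · exact Submodule.subset_span ⟨(g, ⟨i, hi⟩), rfl⟩
    · rw [pow_eq_zero_of_le (not_lt.mp hi) (x_pow χ a), mul_zero]; exact P.zero_mem
  have hxg : ∀ i g, ∃ c : k, x χ a ^ i * grp χ a g = c • (grp χ a g * x χ a ^ i) := by
    intro i g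
    induction i with
    | zero => exact ⟨1, by simp⟩
    | succ i ih =>
      obtain ⟨c, hc⟩ := ih
      exact ⟨χ g * c, by
        rw [pow_succ, mul_assoc, x_mul_grp, mul_smul_comm, ← mul_assoc, hc, smul_mul_assoc,
          smul_smul, mul_assoc, ← pow_succ]⟩
  have hg : ∀ g, ∀ u ∈ P, grp χ a g * u ∈ P := by
    intro g u hu
    induction hu using Submodule.span_induction with
    | mem u hu =>
      obtain ⟨p, rfl⟩ := hu
      simp only [← mul_assoc, ← grp_mul]
      exact hP _ _
    | zero => simp
    | add u v _ _ hu hv => rw [mul_add]; exact P.add_mem hu hv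
    | smul c u _ hu => rw [mul_smul_comm]; exact P.smul_mem _ hu
  have hx : ∀ u ∈ P, x χ a * u ∈ P := by
    intro u hu
    induction hu using Submodule.span_induction with
    | mem u hu =>
      obtain ⟨p, rfl⟩ := hu
      simp only [← mul_assoc, x_mul_grp, smul_mul_assoc]
      rw [mul_assoc, ← pow_succ']
      exact P.smul_mem _ (hP _ _)
    | zero => simp
    | add u v _ _ hu hv => rw [mul_add]; exact P.add_mem hu hv
    | smul c u _ hu => rw [mul_smul_comm]; exact P.smul_mem _ hu
  have hall : ∀ h : HD χ a, ∀ u ∈ P, h * u ∈ P := by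
    intro h
    induction h using induction with
    | hk c => intro u hu; rw [← Algebra.smul_def]; exact P.smul_mem _ hu
    | hg g => exact hg g
    | hx => exact hx
    | hm v w hv hw => intro u hu; rw [mul_assoc]; exact hv _ (hw _ hu)
    | ha v w hv hw => intro u hu; rw [add_mul]; exact P.add_mem (hv _ hu) (hw _ hu)
  have htop : P = ⊤ := by
    rw [eq_top_iff]
    intro h _
    have := hall h 1 (by simpa [grp_one] using hP 1 0)
    simpa using this
  exact Module.Finite.of_fg_top (htop ▸ Submodule.fg_span (Set.finite_range _))

end HD
end Presentation

section OneDim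

variable {k : Type u} [Field k] {G : Type v} [CommGroup G] [Finite G] (χ : G →* kˣ) (a : G)

instance : BijectiveAntipode k (HD χ a) := ⟨HD.antipode_bijective⟩

/-- The extension of a character `γ ∈ Γ = Hom(G, kˣ)` to an algebra map on `H_D` by `γ(x) = 0`. -/
def charExt (γ : G →* kˣ) : HD χ a →ₐ[k] k :=
  HD.lift ((Units.coeHom k).comp γ) 0 (zero_pow HD.orderOf_chi_pos.ne') (fun g => by simp)

/-- A character `γ ∈ Γ`, regarded as an element of `H_D^*`. -/
def charDual (γ : G →* kˣ) : DualAlg k (HD χ a) := WithConv.toConv (charExt χ a γ).toLinearMap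

/-- `α = β g`, i.e. `α(h γ) = β(h) γ(g)` for all `h ∈ G` and `γ ∈ Γ`. -/
def IsDecomp (α : DrinfeldDouble k (HD χ a) →ₐ[k] k) (β : G →* kˣ) (g : G) : Prop :=
  ∀ (h : G) (γ : G →* kˣ),
    α (DrinfeldDouble.tmul (charDual χ a γ) (HD.grp χ a h)) = (β h : k) * (γ g : k)

/-- The Yetter-Drinfel'd module `k_α`: the field `k`, on which `D(H_D)` acts by
`u · c = α(u) c`. -/
def oneDim (α : DrinfeldDouble k (HD χ a) →ₐ[k] k) : YetterDrinfeld k (HD χ a) k :=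
  YetterDrinfeld.ofDouble ((Algebra.lmul k k).comp α)

/-- The Yetter-Drinfel'd module `H_D ·_β g`, the submodule of `H_β` generated by `g ∈ G`, where
`β ∈ Γ` is extended to `H_D` by `β(x) = 0`. -/
def cyclic (β : G →* kˣ) (g : G) : YetterDrinfeld k (HD χ a)
    ((YetterDrinfeld.HBeta (charExt χ a β)).orbit (HD.grp χ a g)) :=
  (YetterDrinfeld.HBeta (charExt χ a β)).orbitYD (HD.grp χ a g) (HD.grp χ a g) (HD.comul_grp g)

/-- The character `gγ ↦ χ⁻¹(g) γ(a)` of `G × Γ`. -/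
def evChar : G × (G →* kˣ) →* kˣ :=
  (χ⁻¹).comp (MonoidHom.fst G (G →* kˣ)) *
    (MonoidHom.eval a).comp (MonoidHom.snd G (G →* kˣ))

/-- The kernel `K` of `gγ ↦ χ⁻¹(g) γ(a)`. -/
def kerEv : Subgroup (G × (G →* kˣ)) := (evChar χ a).ker

/-- Isomorphism classes of modules over the Drinfel'd double of `H_D`. -/
def IsoClass : Type (max u v + 1) :=
  Quotient (CategoryTheory.isIsomorphicSetoid
    (ModuleCat.{max u v} (DrinfeldDouble k (HD χ a))))

variable {χ a}

/-- The isomorphism class of a `D(H_D)`-module. -/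
def IsoClass.mk (M : ModuleCat.{max u v} (DrinfeldDouble k (HD χ a))) : IsoClass χ a :=
  Quotient.mk _ M

variable (χ a)

/-- The set of isomorphism classes of the `D(H_D)`-modules of dimension one over `k`. -/
def oneDimClasses : Set (IsoClass χ a) :=
  {c | ∃ M : ModuleCat.{max u v} (DrinfeldDouble k (HD χ a)),
    Module.finrank k (RestrictScalars k (DrinfeldDouble k (HD χ a)) M) = 1 ∧ IsoClass.mk M = c}

end OneDim

end

end KropRadford

open KropRadford

open scoped TensorProduct

/-! An algebra map `α : D(H) → k` is determined by its restrictions to the subalgebras `H` and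
`H^*`, because `f ⊗ h = (f ⊗ 1)(1 ⊗ h)`. On `H` the nilpotent `x` must go to `0`, so that the
restriction is a character `β` of `G` extended by zero. On `H^*` every functional vanishing on `G`
is nilpotent: by the `q`-binomial formula, `Δ(g xⁿ)` is a combination of `g xⁱ ⊗ g aⁱ xʲ` with `i +
j = n`, so each further convolution factor must absorb at least one `x`. Hence `α` on `H^*` sees
only the restriction to `G`, a function in the span of `Γ`, and by Pontryagin duality the character
of `Γ` so obtained is evaluation at a unique `g`. This gives the pair `(g, β)` (`exists_isDecomp`,
`IsDecomp.pair_unique`), and it also shows that the pair determines `α` (`IsDecomp.algHom_unique`).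

As a Yetter-Drinfel'd module, `k_α` has action `h · c = β(h) c` and coaction `c ↦ c ⊗ g`.
Compatibility of the two at `h = x` says exactly that `(χ(g) - β(a)) g x = 0`. The same element
occurs on the other side, since `x ·_β g = (χ(g) - β(a)) g x`. Once it vanishes, `H ·_β g` is the
line through `g`, with action through `β` and coaction `g ↦ g ⊗ g`, so `1 ↦ g` is the isomorphism
(`isIso_oneDim_cyclic`).

The lemmas assume the vanishing of `(χ(g) - β(a)) g x` rather than `χ(g) = β(a)`, which covers the
case `χ(a) = 1` as well, where `x = 0` and the pair is unconstrained. If `χ(a) ≠ 1`, a two-by-two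
matrix representation shows `g x ≠ 0`, and the condition becomes `(g, β) ∈ K`. Conversely, for a
pair in `K` the line `H ·_β g` is itself a `D(H)`-module, and the algebra map through which `D(H)`
acts on it decomposes as `β g`. The bijection follows, because a one-dimensional module is
determined up to isomorphism by its algebra map to `k`. -/

namespace KropRadford

noncomputable section

open Coalgebra HopfAlgebra WithConv

/-! ### The algebra `H_D`: spanning monomials, nonvanishing of `x`, nilpotent functionals -/

namespace HD

variable {k : Type u} [Field k] {G : Type v} [CommGroup G] {χ : G →* kˣ} {a : G}

/-- The elements `g xⁱ` span `H_D`. -/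
lemma span_grp_mul_x_pow :
    Submodule.span k (Set.range fun p : G × ℕ => grp χ a p.1 * x χ a ^ p.2) = ⊤ := by
  set P : Submodule k (HD χ a) :=
    Submodule.span k (Set.range fun p : G × ℕ => grp χ a p.1 * x χ a ^ p.2) with hPdef
  have hP : ∀ g i, grp χ a g * x χ a ^ i ∈ P := fun g i => Submodule.subset_span ⟨(g, i), rfl⟩
  have hs : ∀ v : HD χ a, (∀ g i, v * (grp χ a g * x χ a ^ i) ∈ P) → ∀ u ∈ P, v * u ∈ P := by
    intro v hv u hu
    have : P ≤ P.comap (LinearMap.mulLeft k v) := by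
      rw [hPdef, Submodule.span_le]
      rintro _ ⟨p, rfl⟩
      exact hv p.1 p.2
    exact this hu
  -- The span is a left ideal, as is checked on the generators of the algebra; it contains `1`, so
  -- it is everything.
  have hall : ∀ h : HD χ a, ∀ u ∈ P, h * u ∈ P := by
    intro h
    induction h using induction with
    | hk c => intro u hu; rw [← Algebra.smul_def]; exact P.smul_mem _ hu
    | hg g => exact hs _ fun g' i => by rw [← mul_assoc, ← grp_mul]; exact hP _ _
    | hx =>
      exact hs _ fun g' i => by
        rw [← mul_assoc, x_mul_grp, smul_mul_assoc, mul_assoc, ← pow_succ']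
        exact P.smul_mem _ (hP _ _)
    | hm v w hv hw => intro u hu; rw [mul_assoc]; exact hv _ (hw _ hu)
    | ha v w hv hw => intro u hu; rw [add_mul]; exact P.add_mem (hv _ hu) (hw _ hu)
  rw [eq_top_iff]
  intro h _
  have := hall h 1 (by simpa [grp_one] using hP 1 0)
  simpa using this

lemma grp_mul_left_injective (g : G) : Function.Injective (grp χ a g * ·) := by
  intro u v h
  have := congrArg (grp χ a g⁻¹ * ·) h
  simpa [← mul_assoc, grp_inv_mul] using this

variable (χ a) in
/-- The two-dimensional representation `g ↦ diag(1, χ(g))`, `x ↦ E₁₂`. -/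
def matrixRep (hχ : χ a ≠ 1) [Finite G] : HD χ a →ₐ[k] Matrix (Fin 2) (Fin 2) k :=
  lift
    { toFun := fun g => !![1, 0; 0, (χ g : k)]
      map_one' := by simp [Matrix.one_fin_two]
      map_mul' := fun g h => by simp }
    !![0, 1; 0, 0]
    (by
      -- `E₁₂² = 0`, so `x ^ ℓ = 0` is respected once `ℓ ≥ 2`. Finiteness of `G` excludes `ℓ = 0`,
      -- for which `orderOf` would encode infinite order.
      have h2 : 2 ≤ orderOf (χ a) := by
        have h0 : 0 < orderOf (χ a) := orderOf_chi_pos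
        have h1 : orderOf (χ a) ≠ 1 := fun h => hχ (orderOf_eq_one_iff.mp h)
        omega
      refine pow_eq_zero_of_le h2 ?_
      rw [pow_two]
      ext i j
      fin_cases i <;> fin_cases j <;> simp)
    (fun g => by
      -- `E₁₂ · diag(1, χ(g)) = χ(g) E₁₂`, whereas `diag(1, χ(g)) · E₁₂ = E₁₂`.
      ext i j
      fin_cases i <;> fin_cases j <;> simp)

variable [Finite G]

/-- A representation in which `x` acts as `E₁₂` detects `x`, so linear independence of the monomials
`g xⁱ` is not needed. For `χ(a) = 1` the relation `x ^ ℓ = 0` reads `x = 0`. -/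
lemma x_ne_zero (hχ : χ a ≠ 1) : x χ a ≠ 0 := by
  intro h
  have h1 : matrixRep χ a hχ (x χ a) = !![0, 1; 0, 0] := lift_x _ _ _ _
  rw [h, map_zero] at h1
  simpa using congrFun (congrFun h1 0) 1

lemma grp_mul_x_ne_zero (hχ : χ a ≠ 1) (g : G) : grp χ a g * x χ a ≠ 0 := fun h =>
  x_ne_zero hχ (grp_mul_left_injective g (by simpa using h))

/-- The summands of `Δ(x) = x ⊗ a + 1 ⊗ x` commute up to the factor `χ(a)`, so the `q`-binomial
theorem applies. Only the shape of the terms matters later: the left factor starts with the same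
`g`, and the exponents add up to `n`. -/
lemma comul_grp_mul_x_pow (g : G) (n : ℕ) : comul (R := k) (grp χ a g * x χ a ^ n) =
    ∑ p ∈ Finset.HasAntidiagonal.antidiagonal n, qBinom (χ a : k) p.1 p.2 •
      ((grp χ a g * x χ a ^ p.1) ⊗ₜ[k] (grp χ a (g * a ^ p.1) * x χ a ^ p.2)) := by
  have hg : ∀ i : ℕ, grp χ a a ^ i = grp χ a (a ^ i) := by
    intro i
    induction i with
    | zero => simp [grp_one]
    | succ i ih => rw [pow_succ, ih, ← grp_mul, pow_succ]
  rw [Bialgebra.comul_mul, Bialgebra.comul_pow, comul_grp, comul_x,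
    add_pow_qBinom (χ a : k) (by simp [x_mul_grp]), Finset.mul_sum]
  refine Finset.sum_congr rfl fun p _ => ?_
  rw [mul_smul_comm, Algebra.TensorProduct.tmul_pow, Algebra.TensorProduct.tmul_pow,
    Algebra.TensorProduct.tmul_mul_tmul, Algebra.TensorProduct.tmul_mul_tmul, one_pow, mul_one,
    hg, ← mul_assoc, ← grp_mul]

/-- If `f ∈ H_D^*` vanishes on `G`, then `fᵐ` vanishes on `g xⁿ` for `n < m`. -/
lemma pow_apply_eq_zero {f : DualAlg k (HD χ a)} (hf : ∀ g, f (grp χ a g) = 0) (m : ℕ) :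
    ∀ n < m, ∀ g, (f ^ m) (grp χ a g * x χ a ^ n) = 0 := by
  induction m with
  | zero => intro n hn; omega
  | succ m ih =>
    intro n hn g
    rw [pow_succ, LinearMap.convMul_apply, comul_grp_mul_x_pow, map_sum, map_sum]
    refine Finset.sum_eq_zero fun p hp => ?_
    rw [Finset.HasAntidiagonal.mem_antidiagonal] at hp
    simp only [map_smul, TensorProduct.map_tmul, LinearMap.mul'_apply]
    -- In `fᵐ⁺¹ = fᵐ * f`, the last factor is evaluated at a group element if the second exponent is
    -- `0`. Otherwise the first exponent is less than `m`, and the induction hypothesis kills the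
    -- first factor.
    rcases Nat.eq_zero_or_pos p.2 with h0 | h0
    · rw [h0, pow_zero, mul_one, hf, mul_zero, smul_zero]
    · rw [ih p.1 (by omega) g, zero_mul, smul_zero]

/-- The power `f ^ ℓ` kills `g xⁿ` for `n < ℓ` by degree, and `g xⁿ = 0` for `n ≥ ℓ`. Consequently
every algebra map from `H^*` to a field kills such an `f`. -/
lemma isNilpotent_of_apply_grp_eq_zero {f : DualAlg k (HD χ a)} (hf : ∀ g, f (grp χ a g) = 0) :
    IsNilpotent f := by
  refine ⟨orderOf (χ a), ofConv_injective (LinearMap.ext_on_range span_grp_mul_x_pow ?_)⟩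
  rintro ⟨g, n⟩
  by_cases hn : n < orderOf (χ a)
  · exact pow_apply_eq_zero hf _ n hn g
  · change (f ^ orderOf (χ a)).ofConv (grp χ a g * x χ a ^ n) = 0
    rw [pow_eq_zero_of_le (not_lt.mp hn) (x_pow χ a), mul_zero, map_zero]

end HD

/-! ### Characters of `G` and algebra maps `H_D^* → k` -/

section Characters

variable {k : Type u} [Field k] {G : Type v} [CommGroup G] [Finite G]

/-- The exponent of a finite group is nonzero, hence invertible in characteristic `0`, and an
algebraically closed field then contains primitive roots of that order. The rest of the argument
uses closedness and characteristic only through this property. -/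
lemma hasEnoughRootsOfUnity_exponent (k : Type u) [Field k] [IsAlgClosed k] [CharZero k]
    (G : Type v) [CommGroup G] [Finite G] : HasEnoughRootsOfUnity k (Monoid.exponent G) :=
  haveI : NeZero (Monoid.exponent G) := ⟨Monoid.exponent_ne_zero_of_finite⟩
  inferInstance

/-- The characters of a finite abelian group span the functions on the group. -/
lemma span_characters [HasEnoughRootsOfUnity k (Monoid.exponent G)] :
    Submodule.span k (Set.range fun (γ : G →* kˣ) (g : G) => (γ g : k)) = ⊤ := by
  cases nonempty_fintype G
  have hc := CommGroup.card_monoidHom_of_hasEnoughRootsOfUnity G k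
  have : Finite (G →* kˣ) := Nat.finite_of_card_ne_zero (hc ▸ Nat.card_pos.ne')
  cases nonempty_fintype (G →* kˣ)
  -- Distinct characters are independent by Dedekind, and there are `|G|` of them, which is the
  -- dimension of the space of functions on `G`.
  have hli : LinearIndependent k fun (γ : G →* kˣ) (g : G) => (γ g : k) :=
    (linearIndependent_monoidHom G k).comp (fun γ : G →* kˣ => (Units.coeHom k).comp γ)
      fun γ γ' h => by
        ext g
        exact DFunLike.congr_fun h g
  refine hli.span_eq_top_of_card_eq_finrank' ?_
  rw [Module.finrank_fintype_fun_eq_card, ← Nat.card_eq_fintype_card, hc,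
    Nat.card_eq_fintype_card]

variable {χ : G →* kˣ} {a : G}

@[simp] lemma charExt_grp (γ : G →* kˣ) (g : G) : charExt χ a γ (HD.grp χ a g) = γ g :=
  HD.lift_grp _ _ _ _ g

@[simp] lemma charExt_x (γ : G →* kˣ) : charExt χ a γ (HD.x χ a) = 0 := HD.lift_x _ _ _ _

@[simp] lemma charDual_apply (γ : G →* kˣ) (h : HD χ a) : charDual χ a γ h = charExt χ a γ h := rfl

lemma charDual_one : charDual χ a 1 = 1 := by
  have : charExt χ a 1 = Bialgebra.counitAlgHom k (HD χ a) := HD.algHom_ext (by simp) (by simp)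
  ext h
  simpa using DFunLike.congr_fun this h

/-- A convolution product of algebra maps into the commutative ring `k` is again an algebra map, so
it suffices to compare the two sides on the generators. With `charDual_one` this makes `Γ → H^*`
multiplicative. -/
lemma charDual_mul (γ γ' : G →* kˣ) :
    charDual χ a (γ * γ') = charDual χ a γ * charDual χ a γ' := by
  have : charExt χ a (γ * γ') = (Algebra.TensorProduct.lmul' k).comp
      ((Algebra.TensorProduct.map (charExt χ a γ) (charExt χ a γ')).comp
        (Bialgebra.comulAlgHom k (HD χ a))) := HD.algHom_ext (by simp) (by simp)
  ext h
  exact DFunLike.congr_fun this h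

lemma HD.grp_ne_zero (g : G) : HD.grp χ a g ≠ 0 := by
  intro h
  have := charExt_grp (χ := χ) (a := a) 1 g
  rw [h, map_zero] at this
  simp at this

variable (χ a) in
/-- The restriction of an algebra map `H_D^* → k` to the characters of `G`. -/
def restrictChars (α : DualAlg k (HD χ a) →ₐ[k] k) : (G →* kˣ) →* kˣ :=
  MonoidHom.toHomUnits
    { toFun := fun γ => α (charDual χ a γ)
      map_one' := by rw [charDual_one, map_one]
      map_mul' := fun γ γ' => by rw [charDual_mul, map_mul] }

/-- An algebra map `H_D^* → k` is the evaluation at `g ∈ G` if it is so on characters. -/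
lemma dual_algHom_eq_eval [HasEnoughRootsOfUnity k (Monoid.exponent G)]
    (α : DualAlg k (HD χ a) →ₐ[k] k) {g : G} (h : ∀ γ, α (charDual χ a γ) = γ g)
    (f : DualAlg k (HD χ a)) : α f = f (HD.grp χ a g) := by
  let res : DualAlg k (HD χ a) →ₗ[k] G → k :=
    { toFun := fun f g => f (HD.grp χ a g)
      map_add' := fun _ _ => rfl
      map_smul' := fun _ _ => rfl }
  -- On `G`, the functional `f` agrees with a combination `f'` of characters. The claim holds for
  -- `f'` by linearity, and the difference `f - f'` vanishes on `G`.
  obtain ⟨f', hf', hres⟩ : ∃ f' ∈ Submodule.span k (Set.range (charDual χ a)), res f' = res f := by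
    have h1 : res f ∈ (⊤ : Submodule k (G → k)) := trivial
    have h2 : (Set.range fun (γ : G →* kˣ) (g : G) => (γ g : k)) =
        res '' Set.range (charDual χ a) := by
      rw [← Set.range_comp]
      congr 1
      ext γ g
      exact (charExt_grp γ g).symm
    rwa [← span_characters, h2, Submodule.span_image] at h1
  have h1 : α f' = f' (HD.grp χ a g) := by
    clear hres
    induction hf' using Submodule.span_induction with
    | mem u hu =>
      obtain ⟨γ, rfl⟩ := hu
      rw [h, charDual_apply, charExt_grp]
    | zero => simp
    | add u v _ _ hu hv => simp [hu, hv]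
    | smul c u _ hu => simp [hu]
  -- The image of a nilpotent element in a field is zero.
  have h2 : α (f - f') = 0 := by
    refine ((HD.isNilpotent_of_apply_grp_eq_zero (f := f - f') fun g' => ?_).map α).eq_zero
    have := congrFun hres g'
    exact sub_eq_zero.mpr this.symm
  rw [map_sub, sub_eq_zero] at h2
  rw [h2, h1]
  exact congrFun hres g

end Characters

/-! ### Algebra maps `D(H_D) → k` as pairs `(g, β)` -/

section Decomposition

variable {k : Type u} [Field k] {G : Type v} [CommGroup G] [Finite G] {χ : G →* kˣ} {a : G}
  {α : DrinfeldDouble k (HD χ a) →ₐ[k] k} {β : G →* kˣ} {g : G}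

lemma DrinfeldDouble.algHom_tmul (α : DrinfeldDouble k (HD χ a) →ₐ[k] k)
    (f : DualAlg k (HD χ a)) (h : HD χ a) :
    α (.tmul f h) = α (.tmul f 1) * α (.tmul 1 h) := by
  rw [← map_mul, DrinfeldDouble.tmul_mul_one_tmul, one_mul]

/-- The image of `x` is nilpotent in a field. Hence an algebra map `H_D → k` is a character of `G`
extended by zero. -/
lemma HD.algHom_x (α : HD χ a →ₐ[k] k) : α (HD.x χ a) = 0 := by
  have h := congrArg α (HD.x_pow χ a)
  rw [map_pow, map_zero] at h
  exact eq_zero_of_pow_eq_zero h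

lemma IsDecomp.algHom_one_tmul (hα : IsDecomp χ a α β g) (h : HD χ a) :
    α (.tmul 1 h) = charExt χ a β h := by
  have : α.comp (DrinfeldDouble.inclRight k (HD χ a)) = charExt χ a β := by
    refine HD.algHom_ext (fun g' => ?_) ?_
    · have := hα g' 1
      rw [charDual_one] at this
      simpa using! this
    · rw [HD.algHom_x, HD.algHom_x]
  exact DFunLike.congr_fun this h

lemma IsDecomp.algHom_charDual_tmul (hα : IsDecomp χ a α β g) (γ : G →* kˣ) :
    α (.tmul (charDual χ a γ) 1) = γ g := by
  simpa [HD.grp_one] using hα 1 γ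

lemma IsDecomp.of_tmul (h₁ : ∀ h, α (.tmul 1 (HD.grp χ a h)) = β h)
    (h₂ : ∀ γ, α (.tmul (charDual χ a γ) 1) = γ g) : IsDecomp χ a α β g := fun h γ => by
  rw [DrinfeldDouble.algHom_tmul, h₁, h₂, mul_comm]

section RootsOfUnity

variable [HasEnoughRootsOfUnity k (Monoid.exponent G)]

lemma IsDecomp.algHom_tmul_one (hα : IsDecomp χ a α β g) (f : DualAlg k (HD χ a)) :
    α (.tmul f 1) = f (HD.grp χ a g) :=
  dual_algHom_eq_eval (α.comp (DrinfeldDouble.inclLeft k (HD χ a))) hα.algHom_charDual_tmul f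

lemma IsDecomp.algHom_tmul (hα : IsDecomp χ a α β g) (f : DualAlg k (HD χ a)) (h : HD χ a) :
    α (.tmul f h) = f (HD.grp χ a g) * charExt χ a β h := by
  rw [DrinfeldDouble.algHom_tmul, hα.algHom_tmul_one, hα.algHom_one_tmul]

lemma IsDecomp.algHom_unique {α' : DrinfeldDouble k (HD χ a) →ₐ[k] k}
    (hα : IsDecomp χ a α β g) (hα' : IsDecomp χ a α' β g) : α = α' := by
  ext u
  induction u using DrinfeldDouble.induction with
  | h0 => simp
  | ht f h => rw [hα.algHom_tmul, hα'.algHom_tmul]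
  | ha u v hu hv => rw [map_add, map_add, hu, hv]

/-- The character `β` is the restriction of `α` to `G`. The values `α(γ) = γ(g)` determine `g`,
because the characters separate the points of `G`. -/
lemma IsDecomp.pair_unique {β' : G →* kˣ} {g' : G} (hα : IsDecomp χ a α β g)
    (hα' : IsDecomp χ a α β' g') : g = g' ∧ β = β' := by
  refine ⟨(CommGroup.forall_apply_eq_apply_iff G (M := k)).mp fun γ => ?_, ?_⟩
  · ext
    rw [← hα.algHom_charDual_tmul, hα'.algHom_charDual_tmul]
  · ext h
    rw [← charExt_grp (χ := χ) (a := a), ← hα.algHom_one_tmul, hα'.algHom_one_tmul, charExt_grp]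

/-- The restriction of `α` to `Γ` is a character of `Γ`, and Pontryagin duality turns it into
evaluation at some `g ∈ G`. -/
lemma exists_isDecomp (α : DrinfeldDouble k (HD χ a) →ₐ[k] k) :
    ∃ (β : G →* kˣ) (g : G), IsDecomp χ a α β g := by
  let β : G →* kˣ := MonoidHom.toHomUnits
    { toFun := fun h => α (.tmul 1 (HD.grp χ a h))
      map_one' := by rw [HD.grp_one, ← DrinfeldDouble.one_def, map_one]
      map_mul' := fun h h' => by
        rw [HD.grp_mul, ← map_mul, DrinfeldDouble.tmul_mul_one_tmul] }
  let η := restrictChars χ a (α.comp (DrinfeldDouble.inclLeft k (HD χ a)))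
  refine ⟨β, CommGroup.monoidHomMonoidHomEquiv G k η, .of_tmul (fun h => rfl) fun γ => ?_⟩
  rw [CommGroup.apply_monoidHomMonoidHomEquiv]
  rfl

end RootsOfUnity

lemma oneDim_act (hα : IsDecomp χ a α β g) (h : HD χ a) (c : k) :
    (oneDim χ a α).act h c = charExt χ a β h * c := by
  rw [← hα.algHom_one_tmul]
  rfl

/-- A coaction is known once paired with all functionals, and `f · c = α(f ⊗ 1) c = f(g) c`. The
whole of `H^*` is needed here, not only the characters of `G`. -/
lemma oneDim_coact [HasEnoughRootsOfUnity k (Monoid.exponent G)] (hα : IsDecomp χ a α β g)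
    (c : k) : (oneDim χ a α).coact c = c ⊗ₜ HD.grp χ a g := by
  refine YetterDrinfeld.ext_pair fun f => ?_
  rw [YetterDrinfeld.pair_tmul, ← hα.algHom_tmul_one]
  exact YetterDrinfeld.pair_coactOfDouble _ f c

end Decomposition

/-! ### Sweedler sums computed from explicit formulas for the comultiplication -/

namespace YetterDrinfeld

variable {k : Type*} [Field k] {H : Type*} [Ring H] [HopfAlgebra k H] {M : Type*} [AddCommGroup M]
  [Module k M]

/-- The Yetter-Drinfel'd compatibility, for an arbitrary representation of the comultiplication. -/
lemma compat_of_comul_eq (V : YetterDrinfeld k H M) {ι : Type*} (s : Finset ι) (l r : ι → H) {h : H}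
    (hh : comul (R := k) h = ∑ i ∈ s, l i ⊗ₜ r i) (m : M) :
    ∑ i ∈ s, TensorProduct.map (V.act (l i)) (LinearMap.mulLeft k (r i)) (V.coact m) =
    ∑ i ∈ s, TensorProduct.map .id (LinearMap.mulRight k (l i)) (V.coact (V.act (r i) m)) := by
  -- Both sides are linear maps `L` and `R` applied to `Δ(h)`, hence do not depend on how `Δ(h)` is
  -- written as a sum.
  let L : H ⊗[k] H →ₗ[k] M ⊗[k] H := LinearMap.applyₗ (V.coact m) ∘ₗ
    TensorProduct.homTensorHomMap (.id k) M H M H ∘ₗ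
    TensorProduct.map V.act.toLinearMap (LinearMap.mul k H)
  let R : H ⊗[k] H →ₗ[k] M ⊗[k] H := TensorProduct.lift
    ((LinearMap.lTensorHom M ∘ₗ (LinearMap.mul k H).flip).compl₂
      (V.coact ∘ₗ LinearMap.applyₗ m ∘ₗ V.act.toLinearMap))
  have hLR : L (comul h) = R (comul h) := by
    rw [← (ℛ k h).eq, map_sum, map_sum]
    exact V.compat h m
  rw [hh, map_sum, map_sum] at hLR
  exact hLR

/-- The action factors through `comul₃`, so any expression of the threefold coproduct may be used;
below these are the obvious ones for `h ∈ G` and for `x`. -/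
lemma betaAct_of_comul_eq [BijectiveAntipode k H] (β : H →ₐ[k] k) {h b : H} {ι : Type*}
    (s : Finset ι) (p q r : ι → H) (hh : comul₃ k H h = ∑ i ∈ s, p i ⊗ₜ (q i ⊗ₜ r i)) :
    betaAct β h b = ∑ i ∈ s, β (q i) • (r i * b * antipodeInv k H (p i)) := by
  rw [betaAct, AlgHom.comp_apply, hh, map_sum, LinearMap.sum_apply]
  simp only [lift_beta_tmul]

/-- The restricted coaction is defined by inverting an injection, so it is accessible only through
its image in `M ⊗ H`. -/
lemma rTensor_subtype_restrict_coact (V : YetterDrinfeld k H M) (N : Submodule k M)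
    (hact : ∀ h, ∀ m ∈ N, V.act h m ∈ N)
    (hcoact : ∀ m ∈ N, V.coact m ∈ LinearMap.range (N.subtype.rTensor H)) (n : N) :
    N.subtype.rTensor H ((V.restrict N hact hcoact).coact n) = V.coact n :=
  LinearMap.congr_fun (V.rTensor_restrictCoact N hcoact) n

end YetterDrinfeld

/-! ### The module `H_D ·_β g` and its isomorphism with `k_α` -/

section Cyclic

open YetterDrinfeld

variable {k : Type u} [Field k] {G : Type v} [CommGroup G] [Finite G] {χ : G →* kˣ} {a : G}
  {β : G →* kˣ} {g : G}

lemma antipodeInv_grp (h : G) : antipodeInv k (HD χ a) (HD.grp χ a h) = HD.grp χ a h⁻¹ :=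
  antipode_injective k _ (by
    rw [antipode_antipodeInv]
    change _ = HD.antipodeLin χ a _
    rw [HD.antipodeLin_grp, inv_inv])

lemma antipodeInv_x : antipodeInv k (HD χ a) (HD.x χ a) = -(HD.grp χ a a⁻¹ * HD.x χ a) :=
  antipode_injective k _ (by
    rw [antipode_antipodeInv]
    change _ = HD.antipodeLin χ a _
    simp [HD.antipodeLin_mul, mul_assoc, HD.grp_inv_mul])

/-- The left side is `β(h) h g h⁻¹`, and `G` is commutative. -/
lemma betaAct_grp (h : G) :
    betaAct (charExt χ a β) (HD.grp χ a h) (HD.grp χ a g) = (β h : k) • HD.grp χ a g := by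
  rw [betaAct_of_comul_eq (charExt χ a β) (Finset.univ : Finset (Fin 1))
    (fun _ => HD.grp χ a h) (fun _ => HD.grp χ a h) (fun _ => HD.grp χ a h) (by simp [comul₃])]
  simp [antipodeInv_grp, ← HD.grp_mul]

/-- The threefold coproduct of `x` is `x ⊗ a ⊗ a + 1 ⊗ x ⊗ a + 1 ⊗ 1 ⊗ x`. The first term gives
`β(a) a g S⁻¹(x) = -β(a) g x`, the second vanishes since `β(x) = 0`, and the third gives `x g = χ(g)
g x`. -/
lemma betaAct_x : betaAct (charExt χ a β) (HD.x χ a) (HD.grp χ a g) =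
    ((χ g : k) - β a) • (HD.grp χ a g * HD.x χ a) := by
  rw [betaAct_of_comul_eq (charExt χ a β) (Finset.univ : Finset (Fin 3))
    ![HD.x χ a, 1, 1] ![HD.grp χ a a, HD.x χ a, 1] ![HD.grp χ a a, HD.grp χ a a, HD.x χ a] (by
      simp [comul₃, Fin.sum_univ_three, TensorProduct.tmul_add, add_assoc])]
  simp [Fin.sum_univ_three, antipodeInv_x, HD.x_mul_grp, sub_smul, ← mul_assoc, ← HD.grp_mul]
  abel

/-- If `χ(g) = β(a)` or `x = 0`, then `H_D` acts on `g ∈ H_β` through `β`. -/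
lemma betaAct_apply_grp (hx : ((χ g : k) - β a) • (HD.grp χ a g * HD.x χ a) = 0) (h : HD χ a) :
    betaAct (charExt χ a β) h (HD.grp χ a g) = charExt χ a β h • HD.grp χ a g := by
  induction h using HD.induction with
  | hk c => simp
  | hg h => rw [betaAct_grp, charExt_grp]
  | hx => rw [betaAct_x, hx, charExt_x, zero_smul]
  | hm u v hu hv =>
    rw [map_mul, Module.End.mul_apply, hv, map_smul, hu, map_mul, smul_smul, mul_comm]
  | ha u v hu hv => rw [map_add, LinearMap.add_apply, hu, hv, map_add, add_smul]

lemma mem_orbit_grp (β : G →* kˣ) (g : G) :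
    HD.grp χ a g ∈ (HBeta (charExt χ a β)).orbit (HD.grp χ a g) :=
  ⟨1, by simp⟩

variable (χ a) in
/-- The element `g` of `H_D ·_β g`. -/
def cyclicGen (β : G →* kˣ) (g : G) : (HBeta (charExt χ a β)).orbit (HD.grp χ a g) :=
  ⟨HD.grp χ a g, mem_orbit_grp β g⟩

lemma cyclicGen_ne_zero : cyclicGen χ a β g ≠ 0 := fun h =>
  HD.grp_ne_zero g (congrArg Subtype.val h)

lemma cyclic_act_gen (hx : ((χ g : k) - β a) • (HD.grp χ a g * HD.x χ a) = 0) (h : HD χ a) :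
    (cyclic χ a β g).act h (cyclicGen χ a β g) = charExt χ a β h • cyclicGen χ a β g :=
  Subtype.ext (betaAct_apply_grp hx h)

/-- Inside `H_β` the coaction is `Δ`, for which `g` is group-like. No condition on `(g, β)` is
involved, unlike for the action. -/
lemma cyclic_coact_gen (β : G →* kˣ) (g : G) :
    (cyclic χ a β g).coact (cyclicGen χ a β g) = cyclicGen χ a β g ⊗ₜ HD.grp χ a g := by
  apply Module.Flat.rTensor_preserves_injective_linearMap (M := HD χ a) _
    ((HBeta (charExt χ a β)).orbit (HD.grp χ a g)).injective_subtype
  exact ((HBeta _).rTensor_subtype_restrict_coact _ _ _ _).trans (HD.comul_grp g)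

lemma exists_smul_cyclicGen (hx : ((χ g : k) - β a) • (HD.grp χ a g * HD.x χ a) = 0)
    (m : (HBeta (charExt χ a β)).orbit (HD.grp χ a g)) : ∃ c : k, c • cyclicGen χ a β g = m := by
  obtain ⟨h, hm⟩ := (mem_orbit _).mp m.2
  exact ⟨charExt χ a β h, Subtype.ext ((betaAct_apply_grp hx h).symm.trans hm)⟩

lemma finrank_cyclic (hx : ((χ g : k) - β a) • (HD.grp χ a g * HD.x χ a) = 0) :
    Module.finrank k ((HBeta (charExt χ a β)).orbit (HD.grp χ a g)) = 1 :=
  finrank_eq_one _ cyclicGen_ne_zero (exists_smul_cyclicGen hx)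

/-- The compatibility of the action and the coaction of `k_α` forces `(χ(g) - β(a)) g x = 0`. -/
lemma IsDecomp.smul_grp_mul_x_eq_zero [HasEnoughRootsOfUnity k (Monoid.exponent G)]
    {α : DrinfeldDouble k (HD χ a) →ₐ[k] k} (hα : IsDecomp χ a α β g) :
    ((χ g : k) - β a) • (HD.grp χ a g * HD.x χ a) = 0 := by
  -- Compatibility at `m = 1`, with `Δ(x) = x ⊗ a + 1 ⊗ x`: since `β(x) = 0`, the left side is `1 ⊗
  -- x g = χ(g) (1 ⊗ g x)` and the right side is `β(a) (1 ⊗ g x)`.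
  have h := (oneDim χ a α).compat_of_comul_eq (h := HD.x χ a) Finset.univ ![HD.x χ a, 1]
    ![HD.grp χ a a, HD.x χ a] (by simp) 1
  simp only [Fin.sum_univ_two, oneDim_coact hα, oneDim_act hα, TensorProduct.map_tmul] at h
  have := congrArg (TensorProduct.lid k _) h
  simp [HD.x_mul_grp] at this
  rw [sub_smul, this, sub_self]

/-- The existence of `α` forces `(χ(g) - β(a)) g x = 0`, which makes `H ·_β g` the line through `g`.
On both lines `H` acts through `β` and the generator coacts by `g`, so `1 ↦ g` respects both
structures. -/
lemma isIso_oneDim_cyclic [HasEnoughRootsOfUnity k (Monoid.exponent G)]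
    {α : DrinfeldDouble k (HD χ a) →ₐ[k] k} (hα : IsDecomp χ a α β g) :
    IsIso (oneDim χ a α) (cyclic χ a β g) := by
  have hx := hα.smul_grp_mul_x_eq_zero
  let e := LinearEquiv.ofBijective (LinearMap.toSpanSingleton k _ (cyclicGen χ a β g))
    ⟨smul_left_injective k cyclicGen_ne_zero, exists_smul_cyclicGen hx⟩
  have he : ∀ c, e c = c • cyclicGen χ a β g := fun _ => rfl
  refine ⟨e, fun h c => ?_, fun c => ?_⟩
  · rw [oneDim_act hα, he, he, map_smul, cyclic_act_gen hx, smul_smul, mul_comm]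
  · rw [oneDim_coact hα, he, map_smul, cyclic_coact_gen, LinearMap.rTensor_tmul,
      TensorProduct.smul_tmul']
    rfl

end Cyclic

/-! ### One-dimensional modules over an algebra -/

section OneDimModules

/-- On a one-dimensional representation, an algebra acts through an algebra map to `k`. -/
lemma exists_algHom_of_finrank_eq_one {k A M : Type*} [Field k] [Ring A] [Algebra k A]
    [AddCommGroup M] [Module k M] (h : Module.finrank k M = 1) (ρ : A →ₐ[k] Module.End k M) :
    ∃ α : A →ₐ[k] k, ∀ u m, ρ u m = α u • m := by
  -- Every endomorphism of a line is a scalar, so the representation takes values in a copy of `k`.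
  have hbij : Function.Bijective (Algebra.ofId k (Module.End k M)) :=
    (LinearEquiv.smul_id_of_finrank_eq_one h).bijective
  let e : k ≃ₐ[k] Module.End k M := AlgEquiv.ofBijective (Algebra.ofId k _) hbij
  refine ⟨(e.symm : Module.End k M →ₐ[k] k).comp ρ, fun u m => ?_⟩
  exact (LinearMap.congr_fun (e.apply_symm_apply (ρ u)) m).symm

section ModuleCat

universe w

variable {k A : Type*} [Field k] [Ring A] [Algebra k A]

/-- An object of `ModuleCat A` carries no action of `k` of its own, so the scalar `α u` acts through
`k → A`. -/
lemma exists_algHom_of_finrank_restrictScalars_eq_one (M : ModuleCat.{w} A)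
    (hM : Module.finrank k (RestrictScalars k A M) = 1) :
    ∃ α : A →ₐ[k] k, ∀ (u : A) (m : M), u • m = algebraMap k A (α u) • m := by
  let : Module k M := Module.compHom M (algebraMap k A)
  have : IsScalarTower k A M := IsScalarTower.of_algebraMap_smul fun _ _ => rfl
  have hM' : Module.finrank k M = 1 := hM
  obtain ⟨α, hα⟩ := exists_algHom_of_finrank_eq_one hM'
    (Algebra.lsmul k k M : A →ₐ[k] Module.End k M)
  exact ⟨α, hα⟩

/-- One-dimensional modules on which an algebra acts through the same algebra map to `k` are
isomorphic. -/
lemma nonempty_iso_of_finrank_restrictScalars_eq_one (M N : ModuleCat.{w} A)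
    (hM : Module.finrank k (RestrictScalars k A M) = 1)
    (hN : Module.finrank k (RestrictScalars k A N) = 1) (α : A →ₐ[k] k)
    (hαM : ∀ (u : A) (m : M), u • m = algebraMap k A (α u) • m)
    (hαN : ∀ (u : A) (n : N), u • n = algebraMap k A (α u) • n) :
    Nonempty (CategoryTheory.Iso M N) := by
  let : Module k M := Module.compHom M (algebraMap k A)
  let : Module k N := Module.compHom N (algebraMap k A)
  have hM' : Module.finrank k M = 1 := hM
  have hN' : Module.finrank k N = 1 := hN
  have : Module.Finite k M := Module.finite_of_finrank_eq_succ hM'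
  have : Module.Finite k N := Module.finite_of_finrank_eq_succ hN'
  -- Any `k`-linear isomorphism will do: `A` acts on both sides by the same scalars, so it is
  -- automatically `A`-linear.
  let e : M ≃ₗ[k] N := LinearEquiv.ofFinrankEq _ _ (hM'.trans hN'.symm)
  let e' : M ≃ₗ[A] N :=
    { e.toAddEquiv with
      map_smul' := fun u m => by
        rw [hαM]
        exact (e.map_smul (α u) m).trans (hαN u (e m)).symm }
  exact ⟨e'.toModuleIso⟩

/-- Isomorphic nonzero modules on which an algebra acts through algebra maps to `k` have the same
algebra map. -/
lemma algHom_eq_of_linearEquiv {M N : Type*} [AddCommGroup M] [Module A M] [AddCommGroup N]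
    [Module A N] (e : M ≃ₗ[A] N) {m : M} (hm : m ≠ 0) {α α' : A →ₐ[k] k}
    (hα : ∀ (u : A) (m : M), u • m = algebraMap k A (α u) • m)
    (hα' : ∀ (u : A) (n : N), u • n = algebraMap k A (α' u) • n) : α = α' := by
  ext u
  let : Module k M := Module.compHom M (algebraMap k A)
  refine smul_left_injective k hm (e.injective ?_)
  change e (algebraMap k A (α u) • m) = e (algebraMap k A (α' u) • m)
  rw [← hα, e.map_smul, e.map_smul, hα']

/-- Restriction along `k → D(H)` puts a second `k`-structure on the space `M`. It agrees with the
original one because `doubleAct` is a map of `k`-algebras. -/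
lemma finrank_restrictScalars_toModuleCat {H M : Type*} [Ring H] [HopfAlgebra k H]
    [BijectiveAntipode k H] [AddCommGroup M] [Module k M] (V : YetterDrinfeld k H M) :
    Module.finrank k (RestrictScalars k (DrinfeldDouble k H) V.toModuleCat) =
      Module.finrank k M := by
  let : Module k V.toModuleCat := Module.compHom _ (algebraMap k (DrinfeldDouble k H))
  let e : V.toModuleCat ≃ₗ[k] M :=
    { toFun := fun m => m
      invFun := fun m => m
      left_inv := fun _ => rfl
      right_inv := fun _ => rfl
      map_add' := fun _ _ => rfl
      map_smul' := fun c m => LinearMap.congr_fun (V.doubleAct.commutes c) m }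
  exact e.finrank_eq

end ModuleCat

/-! ### Classification of the one-dimensional `D(H_D)`-modules by `K` -/

variable {k : Type u} [Field k] {G : Type v} [CommGroup G] [Finite G] {χ : G →* kˣ} {a : G}
  {β : G →* kˣ} {g : G}

lemma mem_kerEv_iff : (g, β) ∈ kerEv χ a ↔ χ g = β a := by
  change (χ g)⁻¹ * β a = 1 ↔ _
  rw [inv_mul_eq_one]

lemma smul_grp_mul_x_of_mem_kerEv (h : (g, β) ∈ kerEv χ a) :
    ((χ g : k) - β a) • (HD.grp χ a g * HD.x χ a) = 0 := by
  rw [mem_kerEv_iff.mp h, sub_self, zero_smul]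

/-- The Drinfel'd double acts on the one-dimensional module `H_D ·_β g` through `β g`. -/
lemma exists_isDecomp_cyclic
    (hx : ((χ g : k) - β a) • (HD.grp χ a g * HD.x χ a) = 0) :
    ∃ α : DrinfeldDouble k (HD χ a) →ₐ[k] k, IsDecomp χ a α β g ∧
      ∀ (u : DrinfeldDouble k (HD χ a)) (m : (cyclic χ a β g).toModuleCat),
        u • m = algebraMap k (DrinfeldDouble k (HD χ a)) (α u) • m := by
  obtain ⟨α, hα⟩ := exists_algHom_of_finrank_eq_one (finrank_cyclic hx) (cyclic χ a β g).doubleAct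
  refine ⟨α, fun h γ => smul_left_injective k (cyclicGen_ne_zero (χ := χ) (a := a) (β := β) (g := g))
    ?_, fun u m => ?_⟩
  -- The scalar is read off at the generator `g`, on which `h ∈ G` acts by `β(h)` and `γ ∈ Γ` acts
  -- by `γ(g)`.
  · beta_reduce
    rw [← hα, YetterDrinfeld.doubleAct_tmul, Module.End.mul_apply, cyclic_act_gen hx, map_smul,
      YetterDrinfeld.dualAct_apply, cyclic_coact_gen, YetterDrinfeld.pair_tmul, charDual_apply,
      charExt_grp, charExt_grp, smul_smul]
  · exact (hα u m).trans (LinearMap.congr_fun ((cyclic χ a β g).doubleAct.commutes (α u)) m).symm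

section RootsOfUnity

variable [HasEnoughRootsOfUnity k (Monoid.exponent G)]

/-- Necessity is the compatibility condition together with `g x ≠ 0`, where `χ(a) ≠ 1` enters. For
sufficiency, `α` is not built from formulas on `D(H)`: it is the algebra map through which `D(H)`
acts on the line `H ·_β g`. -/
lemma exists_isDecomp_iff (hχ : χ a ≠ 1) :
    (∃ α : DrinfeldDouble k (HD χ a) →ₐ[k] k, IsDecomp χ a α β g) ↔ (g, β) ∈ kerEv χ a := by
  constructor
  · rintro ⟨α, hα⟩
    rw [mem_kerEv_iff]
    ext
    exact sub_eq_zero.mp ((smul_eq_zero.mp hα.smul_grp_mul_x_eq_zero).resolve_right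
      (HD.grp_mul_x_ne_zero hχ g))
  · intro h
    obtain ⟨α, hα, -⟩ := exists_isDecomp_cyclic (smul_grp_mul_x_of_mem_kerEv h)
    exact ⟨α, hα⟩

lemma bijOn_cyclic (hχ : χ a ≠ 1) :
    Set.BijOn (fun p : G × (G →* kˣ) => IsoClass.mk (cyclic χ a p.2 p.1).toModuleCat)
      (kerEv χ a) (oneDimClasses χ a) := by
  have hfin : ∀ p ∈ kerEv χ a, Module.finrank k (RestrictScalars k (DrinfeldDouble k (HD χ a))
      (cyclic χ a p.2 p.1).toModuleCat) = 1 := fun p hp =>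
    (finrank_restrictScalars_toModuleCat _).trans (finrank_cyclic (smul_grp_mul_x_of_mem_kerEv hp))
  refine ⟨fun p hp => ⟨_, hfin p hp, rfl⟩, ?_, ?_⟩
  -- Injectivity: isomorphic lines have the same algebra map to `k`, and the pair is recovered from
  -- it.
  · rintro ⟨g, β⟩ hp ⟨g', β'⟩ hp' h
    obtain ⟨e⟩ := Quotient.exact h
    obtain ⟨α, hα, hact⟩ := exists_isDecomp_cyclic (smul_grp_mul_x_of_mem_kerEv hp)
    obtain ⟨α', hα', hact'⟩ := exists_isDecomp_cyclic (smul_grp_mul_x_of_mem_kerEv hp')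
    obtain rfl := algHom_eq_of_linearEquiv e.toLinearEquiv
      (cyclicGen_ne_zero (χ := χ) (a := a) (β := β) (g := g)) hact hact'
    obtain ⟨rfl, rfl⟩ := hα.pair_unique hα'
    rfl
  -- Surjectivity: the algebra map of the line `M` decomposes as some `β g`, and `H ·_β g` is the
  -- candidate.
  · rintro _ ⟨M, hM, rfl⟩
    obtain ⟨α, hα⟩ := exists_algHom_of_finrank_restrictScalars_eq_one M hM
    obtain ⟨β, g, hd⟩ := exists_isDecomp α
    have hp : (g, β) ∈ kerEv χ a := (exists_isDecomp_iff hχ).mp ⟨α, hd⟩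
    obtain ⟨α', hd', hact⟩ := exists_isDecomp_cyclic (smul_grp_mul_x_of_mem_kerEv hp)
    -- The algebra maps of `M` and of `H ·_β g` both decompose as `β g`, hence coincide.
    obtain rfl := hd.algHom_unique hd'
    exact ⟨(g, β), hp, Quotient.sound
      (nonempty_iso_of_finrank_restrictScalars_eq_one _ _ (hfin _ hp) hM α hact hα)⟩

end RootsOfUnity

end OneDimModules

end

end KropRadford

open KropRadford

theorem proposition3p2 {k : Type*} [Field k] [IsAlgClosed k] [CharZero k]
    {G : Type*} [CommGroup G] [Finite G] (χ : G →* kˣ) (a : G) :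
    (∀ α : DrinfeldDouble k (HD χ a) →ₐ[k] k,
      (∃! p : G × (G →* kˣ), IsDecomp χ a α p.2 p.1) ∧
      ∀ (β : G →* kˣ) (g : G), IsDecomp χ a α β g →
        YetterDrinfeld.IsIso (oneDim χ a α) (cyclic χ a β g)) ∧
    (χ a ≠ 1 →
      (∀ (β : G →* kˣ) (g : G),
        (∃ α : DrinfeldDouble k (HD χ a) →ₐ[k] k, IsDecomp χ a α β g) ↔ (g, β) ∈ kerEv χ a) ∧
      Set.BijOn (fun p : G × (G →* kˣ) => IsoClass.mk (cyclic χ a p.2 p.1).toModuleCat)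
        (kerEv χ a) (oneDimClasses χ a)) := by
  have := hasEnoughRootsOfUnity_exponent k G
  refine ⟨fun α => ⟨?_, fun β g hα => isIso_oneDim_cyclic hα⟩,
    fun hχ => ⟨fun β g => exists_isDecomp_iff hχ, bijOn_cyclic hχ⟩⟩
  obtain ⟨β, g, hα⟩ := exists_isDecomp α
  refine ⟨(g, β), hα, fun p hp => ?_⟩
  obtain ⟨h₁, h₂⟩ := IsDecomp.pair_unique hp hα
  exact Prod.ext h₁ h₂
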